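/- Let $s=(s_n)_{n\ge 0}$ be a normalized indeterminate Hamburger moment sequence, i.e. there are at least two probability measures $\mu$ on $\mathbb R$ with moments of every order and $\int x^n\,d\mu(x)=s_n$ for all $n\ge 0$. Assume that $s$ is Stieltjes, i.e. at least one of these measures is supported by $[0,\infty)$. Let $P_n$ be the orthonormal polynomials of $s$ (with positive leading coefficients), let $Q_n(x)=\int\frac{P_n(x)-P_n(y)}{x-y}\,d\mu(y)$ be the polynomials of the second kind, and consider the entire functions $$A(z)=z\sum_{k=0}^\infty Q_k(z)Q_k(0),\qquad B(z)=-1+z\sum_{k=0}^\infty P_k(z)Q_k(0),$$ $$C(z)=1+z\sum_{k=0}^\infty Q_k(z)P_k(0),\qquad D(z)=z\sum_{k=0}^\infty P_k(z)P_k(0).$$ Let $\alpha(s)=\lim_{x\to-\infty}\frac{D(x)}{B(x)}=\lim_{n\to\infty}\frac{P_n(0)}{Q_n(0)}$ (both limits exist in $\mathbb R$ and are equal). The zeros of $A$ in $\mathbb C$ are all real and form an infinite strictly increasing sequence $\alpha_1<\alpha_2<\cdots$. The function $l(x)=C(x)/A(x)$ is strictly decreasing in each of the intervals $(-\infty,\alpha_1),(\alpha_1,\alpha_2),(\alpha_2,\alpha_3),\ldots$,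 with one-sided limits $$\lim_{x\to\alpha_k^-}l(x)=-\infty,\qquad \lim_{x\to\alpha_k^+}l(x)=+\infty,\qquad k=1,2,\ldots.$$ Moreover $$\alpha(s)=\lim_{x\to-\infty}\frac{C(x)}{A(x)}.$$ -/

import Mathlib

open MeasureTheory Filter Topology Polynomial

noncomputable section

namespace MomentProblem

/-- `μ` is a solution of the (normalized) Hamburger moment problem for `s`: a probability measure
on `ℝ` with moments of every order, whose `n`-th moment is `s n`. -/
structure IsSolution (s : ℕ → ℝ) (μ : Measure ℝ) : Prop where
  prob : IsProbabilityMeasure μ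
  integrable : ∀ n : ℕ, Integrable (fun x : ℝ => x ^ n) μ
  moment : ∀ n : ℕ, ∫ x : ℝ, x ^ n ∂μ = s n

/-- `s` is a normalized Hamburger moment sequence with more than one solution. -/
def IsIndeterminate (s : ℕ → ℝ) : Prop :=
  ∃ μ ν : Measure ℝ, IsSolution s μ ∧ IsSolution s ν ∧ μ ≠ ν

/-- `s` has a solution supported by `[0, ∞)`. -/
def IsStieltjes (s : ℕ → ℝ) : Prop :=
  ∃ μ : Measure ℝ, IsSolution s μ ∧ μ (Set.Iio 0) = 0

/-- The moment functional `p ↦ ∫ p dμ` (for any solution `μ`), expressed by the moments. -/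
def momentFunctional (s : ℕ → ℝ) (p : ℝ[X]) : ℝ :=
  p.sum fun i c => c * s i

/-- The monic orthogonal polynomials: Gram--Schmidt applied to `1, X, X², …` with respect to
the inner product `(p, q) ↦ momentFunctional s (p * q)`. -/
def monicOrth (s : ℕ → ℝ) (n : ℕ) : ℝ[X] :=
  X ^ n - ∑ k : Fin n,
    C (momentFunctional s (X ^ n * monicOrth s k) /
      momentFunctional s (monicOrth s k * monicOrth s k)) * monicOrth s k
termination_by n
decreasing_by all_goals exact k.isLt

/-- The orthonormal polynomials `P_n` (with positive leading coefficients). -/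
def P (s : ℕ → ℝ) (n : ℕ) : ℝ[X] :=
  C (√(momentFunctional s (monicOrth s n * monicOrth s n)))⁻¹ * monicOrth s n

/-- The polynomials of the second kind
`Q_n(x) = ∫ (P_n(x) - P_n(y)) / (x - y) dμ(y)`, where
`(x ^ m - y ^ m) / (x - y) = ∑_{i < m} x ^ i y ^ (m - 1 - i)`. -/
def Q (s : ℕ → ℝ) (n : ℕ) : ℝ[X] :=
  (P s n).sum fun m c => ∑ i ∈ Finset.range m, C (c * s (m - 1 - i)) * X ^ i

section Nevanlinna

variable {𝕜 : Type} [RCLike 𝕜]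

/- The Nevanlinna functions of two variables, on `ℂ` (`𝕜 = ℂ`) and their restrictions to
the real line (`𝕜 = ℝ`). -/

def A₂ (s : ℕ → ℝ) (u v : 𝕜) : 𝕜 :=
  (u - v) * ∑' k : ℕ, aeval u (Q s k) * aeval v (Q s k)

def B₂ (s : ℕ → ℝ) (u v : 𝕜) : 𝕜 :=
  -1 + (u - v) * ∑' k : ℕ, aeval u (P s k) * aeval v (Q s k)

def C₂ (s : ℕ → ℝ) (u v : 𝕜) : 𝕜 :=
  1 + (u - v) * ∑' k : ℕ, aeval u (Q s k) * aeval v (P s k)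

def D₂ (s : ℕ → ℝ) (u v : 𝕜) : 𝕜 :=
  (u - v) * ∑' k : ℕ, aeval u (P s k) * aeval v (P s k)

/- The Nevanlinna functions of one variable. -/

def nevA (s : ℕ → ℝ) (u : 𝕜) : 𝕜 := A₂ s u 0

def nevB (s : ℕ → ℝ) (u : 𝕜) : 𝕜 := B₂ s u 0

def nevC (s : ℕ → ℝ) (u : 𝕜) : 𝕜 := C₂ s u 0

def nevD (s : ℕ → ℝ) (u : 𝕜) : 𝕜 := D₂ s u 0

end Nevanlinna

/-- The quantity `α(s) = lim_{x → -∞} D(x) / B(x)`. -/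
def alpha (s : ℕ → ℝ) : ℝ :=
  limUnder atBot fun x : ℝ => nevD s x / nevB s x

end MomentProblem

end

/-!
The function `l = C / A` is governed by the Christoffel-Darboux type identity
`A(z) C(w) - A(w) C(z) = (z - w) ∑ Q_k(z) Q_k(w)`: on the diagonal it gives
`l' = -∑ Q_k² / A²` on the real line, and at `w = conj z` it shows that `A` has no non-real zero.
The series converge because the Stieltjes transforms `∫ (x - z)⁻¹ dμ` of two solutions differ at
some non-real `z`, and each of the two values `b` makes `b P_k(z) + Q_k(z)` square summable;
expressing `P_n, Q_n` at one point by those at another through a Volterra kernel carries square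
summability to the whole plane.

In the Stieltjes case `P_k` and `Q_k` have constant alternating signs on `(-∞, 0]`, so up to a
vanishing error `C(x) / A(x)` and `D(x) / B(x)` are means of the ratios `P_k(0) / Q_k(0)` with
positive weights. Since the degrees increase, the mass of the weights moves to `k = ∞` as
`x → -∞`, and both quotients have the same limit as the ratios. The same comparison of degrees
shows that `A` outgrows every polynomial on `(-∞, 0]`; as an entire function of minimal exponential
type with finitely many zeros is a polynomial, `A` has infinitely many zeros.
-/

noncomputable section

namespace MomentProblem

variable {s : ℕ → ℝ}

/-! ### Orthonormal polynomials and polynomials of the second kind -/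

section MomentFunctional

/-- The moment functional as a linear map. -/
def momentMap (s : ℕ → ℝ) : ℝ[X] →ₗ[ℝ] ℝ :=
  lsum fun i => LinearMap.mulRight ℝ (s i)

theorem momentFunctional_eq_momentMap (s : ℕ → ℝ) (p : ℝ[X]) :
    momentFunctional s p = momentMap s p := by
  simp [momentFunctional, momentMap, lsum_apply]

@[simp]
theorem momentMap_monomial (s : ℕ → ℝ) (n : ℕ) (c : ℝ) :
    momentMap s (monomial n c) = c * s n := by
  simp [momentMap, lsum_apply, sum_monomial_index]

theorem momentMap_C (s : ℕ → ℝ) (c : ℝ) : momentMap s (C c) = c * s 0 := by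
  rw [← monomial_zero_left, momentMap_monomial]

@[simp]
theorem momentMap_C_mul (s : ℕ → ℝ) (c : ℝ) (p : ℝ[X]) :
    momentMap s (C c * p) = c * momentMap s p := by
  rw [← smul_eq_C_mul, map_smul, smul_eq_mul]

/-- The linear operator `p ↦ ∫ (p(x) - p(y)) / (x - y) dμ(y)`, which maps `P s n` to `Q s n`. -/
def secondKind (s : ℕ → ℝ) : ℝ[X] →ₗ[ℝ] ℝ[X] :=
  lsum fun m => ∑ i ∈ Finset.range m, (monomial i).comp (LinearMap.mulRight ℝ (s (m - 1 - i)))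

theorem Q_eq_secondKind (s : ℕ → ℝ) (n : ℕ) : Q s n = secondKind s (P s n) := by
  simp only [Q, C_mul_X_pow_eq_monomial]
  simp [secondKind, lsum_apply]

theorem secondKind_monomial (s : ℕ → ℝ) (n : ℕ) (c : ℝ) :
    secondKind s (monomial n c) = ∑ i ∈ Finset.range n, monomial i (c * s (n - 1 - i)) := by
  simp [secondKind, lsum_apply, sum_monomial_index]

@[simp]
theorem secondKind_C (s : ℕ → ℝ) (c : ℝ) : secondKind s (C c) = 0 := by
  simpa using secondKind_monomial s 0 c

@[simp]
theorem secondKind_C_mul (s : ℕ → ℝ) (c : ℝ) (p : ℝ[X]) :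
    secondKind s (C c * p) = C c * secondKind s p := by
  rw [← smul_eq_C_mul, map_smul, smul_eq_C_mul]

theorem secondKind_X_mul (s : ℕ → ℝ) (p : ℝ[X]) :
    secondKind s (X * p) = X * secondKind s p + C (momentMap s p) := by
  induction p using Polynomial.induction_on' with
  | add p q hp hq => rw [mul_add, map_add, hp, hq, map_add, map_add, map_add]; ring
  | monomial n c =>
    rw [X_mul_monomial, secondKind_monomial, secondKind_monomial, momentMap_monomial,
      Finset.sum_range_succ', Finset.mul_sum]
    congr 1
    refine Finset.sum_congr rfl fun i _ => ?_
    rw [X_mul_monomial, show n + 1 - 1 - (i + 1) = n - 1 - i by lia]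

theorem secondKind_X_sub_C_mul (s : ℕ → ℝ) (w : ℝ) (p : ℝ[X]) :
    secondKind s ((X - C w) * p) = (X - C w) * secondKind s p + C (momentMap s p) := by
  rw [sub_mul, map_sub, secondKind_X_mul, secondKind_C_mul]; ring

theorem secondKind_eq_X_mul_divX (s : ℕ → ℝ) (p : ℝ[X]) :
    secondKind s p = X * secondKind s p.divX + C (momentMap s p.divX) := by
  conv_lhs => rw [← X_mul_divX_add p, map_add, secondKind_C, add_zero, secondKind_X_mul]

theorem degree_secondKind (hs : s 0 ≠ 0) {p : ℝ[X]} {n : ℕ} (hp : p.natDegree = n + 1) :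
    (secondKind s p).degree = n := by
  have hdivX : p.divX.natDegree = n := by rw [natDegree_divX_eq_natDegree_tsub_one, hp]; rfl
  rw [secondKind_eq_X_mul_divX]
  induction n generalizing p with
  | zero =>
    obtain ⟨c, hc⟩ := natDegree_eq_zero.1 hdivX
    have hc0 : c ≠ 0 := by
      rintro rfl
      rw [← X_mul_divX_add p, ← hc] at hp
      simp at hp
    rw [← hc, secondKind_C, mul_zero, zero_add, momentMap_C]
    exact degree_C (mul_ne_zero hc0 hs)
  | succ n ih =>
    have hdeg : (X * secondKind s p.divX).degree = ((n + 1 : ℕ) : WithBot ℕ) := by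
      rw [secondKind_eq_X_mul_divX, degree_mul, degree_X, add_comm,
        ih hdivX (by rw [natDegree_divX_eq_natDegree_tsub_one, hdivX]; rfl), Nat.cast_succ]
    rw [degree_add_C (by rw [hdeg]; exact WithBot.coe_lt_coe.2 n.succ_pos), hdeg]

theorem X_sub_C_mul_divByMonic_add (p : ℝ[X]) (w : ℝ) :
    (X - C w) * (p /ₘ (X - C w)) + C (p.eval w) = p := by
  rw [add_comm, ← modByMonic_X_sub_C_eq_C_eval, modByMonic_add_div]

theorem degree_divByMonic_X_sub_C_lt {p : ℝ[X]} {n : ℕ} (hp : p.degree ≤ n) (w : ℝ) :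
    (p /ₘ (X - C w)).degree < n := by
  rcases eq_or_ne p 0 with rfl | hp0
  · simp
  · exact (degree_divByMonic_lt p (X - C w) hp0 (by simp)).trans_le hp

theorem momentMap_divByMonic_X_sub_C (s : ℕ → ℝ) (p : ℝ[X]) (w : ℝ) :
    momentMap s (p /ₘ (X - C w)) = (secondKind s p).eval w := by
  conv_rhs => rw [← X_sub_C_mul_divByMonic_add p w, map_add, secondKind_X_sub_C_mul]
  simp

theorem momentMap_divByMonic_mul_sub (s : ℕ → ℝ) (p q : ℝ[X]) (w : ℝ) :
    momentMap s (p /ₘ (X - C w) * q) - momentMap s (p * (q /ₘ (X - C w))) =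
      q.eval w * (secondKind s p).eval w - p.eval w * (secondKind s q).eval w := by
  rw [← momentMap_divByMonic_X_sub_C, ← momentMap_divByMonic_X_sub_C, ← momentMap_C_mul,
    ← momentMap_C_mul, ← map_sub, ← map_sub]
  congr 1
  linear_combination (p /ₘ (X - C w)) * -(X_sub_C_mul_divByMonic_add q w) +
    (q /ₘ (X - C w)) * (X_sub_C_mul_divByMonic_add p w)

end MomentFunctional

section PosDef

theorem IsSolution.integrable_eval {μ : Measure ℝ} (hμ : IsSolution s μ) (p : ℝ[X]) :
    Integrable (fun x => p.eval x) μ := by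
  simp only [eval_eq_sum_range]
  exact integrable_finsetSum _ fun i _ => (hμ.integrable i).const_mul _

theorem IsSolution.integral_eval {μ : Measure ℝ} (hμ : IsSolution s μ) (p : ℝ[X]) :
    ∫ x, p.eval x ∂μ = momentMap s p := by
  induction p using Polynomial.induction_on' with
  | add p q hp hq =>
    simp only [eval_add, map_add]
    rw [integral_add (hμ.integrable_eval p) (hμ.integrable_eval q), hp, hq]
  | monomial n c => simp [integral_const_mul, hμ.moment]

theorem IsSolution.momentMap_mul_self_nonneg {μ : Measure ℝ} (hμ : IsSolution s μ) (p : ℝ[X]) :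
    0 ≤ momentMap s (p * p) := by
  rw [← hμ.integral_eval]
  exact integral_nonneg fun x => by simpa using mul_self_nonneg _

theorem IsSolution.ae_eval_eq_zero {μ : Measure ℝ} (hμ : IsSolution s μ) {p : ℝ[X]}
    (hp : momentMap s (p * p) = 0) : ∀ᵐ x ∂μ, p.eval x = 0 := by
  rw [← hμ.integral_eval, integral_eq_zero_iff_of_nonneg
    (fun x => by simpa using mul_self_nonneg _) (hμ.integrable_eval _)] at hp
  filter_upwards [hp] with x hx
  simpa using hx

/-- Positive definiteness of the moment functional, which is all that the algebra of orthonormal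
polynomials needs. -/
def IsPosDef (s : ℕ → ℝ) : Prop :=
  ∀ p : ℝ[X], p ≠ 0 → 0 < momentMap s (p * p)

/- If `∫ p² dμ = 0`, every solution is carried by the finitely many roots of `p`, so by
interpolation the mass of any set is the integral of a polynomial. -/
theorem IsIndeterminate.isPosDef (h : IsIndeterminate s) : IsPosDef s := by
  obtain ⟨μ, ν, hμ, hν, hne⟩ := h
  refine fun p hp => (hμ.momentMap_mul_self_nonneg p).lt_of_ne' fun h0 => hne ?_
  ext E hE
  classical
  let q : ℝ[X] := Lagrange.interpolate p.roots.toFinset id (E.indicator 1)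
  have measure_eq : ∀ σ : Measure ℝ, IsSolution s σ → σ.real E = momentMap s q := by
    intro σ hσ
    rw [← hσ.integral_eval, ← integral_indicator_one hE]
    refine integral_congr_ae ?_
    filter_upwards [hσ.ae_eval_eq_zero h0] with x hx
    have hx' : x ∈ p.roots.toFinset := by simp [hp, hx]
    exact (Lagrange.eval_interpolate_at_node (v := id) (E.indicator (1 : ℝ → ℝ))
      Function.injective_id.injOn hx').symm
  have := hμ.prob
  have := hν.prob
  rw [← ENNReal.toReal_eq_toReal_iff' (measure_ne_top _ _) (measure_ne_top _ _)]
  exact (measure_eq μ hμ).trans (measure_eq ν hν).symm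

theorem IsPosDef.zero_ne_zero (hs : IsPosDef s) : s 0 ≠ 0 := by
  have := hs 1 one_ne_zero
  rw [mul_one, ← C_1, momentMap_C, one_mul] at this
  exact this.ne'

end PosDef

section OrthonormalPolynomials

theorem monicOrth_eq (s : ℕ → ℝ) (n : ℕ) : monicOrth s n = X ^ n - ∑ k ∈ Finset.range n,
    C (momentMap s (X ^ n * monicOrth s k) / momentMap s (monicOrth s k * monicOrth s k)) *
      monicOrth s k := by
  rw [monicOrth, ← Fin.sum_univ_eq_sum_range (fun k =>
    C (momentMap s (X ^ n * monicOrth s k) / momentMap s (monicOrth s k * monicOrth s k)) *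
      monicOrth s k)]
  simp only [momentFunctional_eq_momentMap]

theorem degree_sum_range_C_mul_lt {R : ℕ → ℝ[X]} {n : ℕ} (hR : ∀ k < n, (R k).degree = k)
    (c : ℕ → ℝ) : (∑ k ∈ Finset.range n, C (c k) * R k).degree < n := by
  refine (degree_sum_le _ _).trans_lt ((Finset.sup_lt_iff (WithBot.bot_lt_coe n)).2 fun k hk => ?_)
  have hk := Finset.mem_range.1 hk
  rw [← smul_eq_C_mul]
  exact (degree_smul_le _ _).trans_lt (by rw [hR k hk]; exact WithBot.coe_lt_coe.2 hk)

theorem degree_monicOrth (s : ℕ → ℝ) (n : ℕ) : (monicOrth s n).degree = n := by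
  induction n using Nat.strong_induction_on with
  | _ n ih =>
    rw [monicOrth_eq, degree_sub_eq_left_of_degree_lt] <;> rw [degree_X_pow]
    exact degree_sum_range_C_mul_lt ih _

theorem monic_monicOrth (s : ℕ → ℝ) (n : ℕ) : (monicOrth s n).Monic := by
  rw [monicOrth_eq]
  exact monic_X_pow_sub (degree_sum_range_C_mul_lt (fun k _ => degree_monicOrth s k) _)

theorem momentMap_monicOrth_mul_of_lt (hs : IsPosDef s) {n k : ℕ} (hk : k < n) :
    momentMap s (monicOrth s n * monicOrth s k) = 0 := by
  induction n using Nat.strong_induction_on generalizing k with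
  | _ n ih =>
    have hpos := hs _ (monic_monicOrth s k).ne_zero
    rw [monicOrth_eq s n, sub_mul, map_sub, Finset.sum_mul, map_sum,
      Finset.sum_eq_single_of_mem k (Finset.mem_range.2 hk)]
    · rw [mul_assoc, momentMap_C_mul, div_mul_cancel₀ _ hpos.ne', sub_self]
    · intro j hj hjk
      rw [mul_assoc, momentMap_C_mul]
      rcases hjk.lt_or_gt with hlt | hgt
      · rw [mul_comm (monicOrth s j) (monicOrth s k), ih k hk hlt, mul_zero]
      · rw [ih j (Finset.mem_range.1 hj) hgt, mul_zero]

/-- The leading coefficient of `P s n`. -/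
def leadP (s : ℕ → ℝ) (n : ℕ) : ℝ :=
  (√(momentMap s (monicOrth s n * monicOrth s n)))⁻¹

theorem P_eq_C_mul_monicOrth (s : ℕ → ℝ) (n : ℕ) : P s n = C (leadP s n) * monicOrth s n := by
  simp only [P, leadP, momentFunctional_eq_momentMap]

theorem leadP_pos (hs : IsPosDef s) (n : ℕ) : 0 < leadP s n :=
  inv_pos.2 (Real.sqrt_pos.2 (hs _ (monic_monicOrth s n).ne_zero))

theorem leadingCoeff_P (s : ℕ → ℝ) (n : ℕ) : (P s n).leadingCoeff = leadP s n := by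
  rw [P_eq_C_mul_monicOrth, leadingCoeff_mul, leadingCoeff_C, (monic_monicOrth s n).leadingCoeff,
    mul_one]

theorem degree_P (hs : IsPosDef s) (n : ℕ) : (P s n).degree = n := by
  rw [P_eq_C_mul_monicOrth, degree_C_mul (leadP_pos hs n).ne', degree_monicOrth]

theorem natDegree_P (hs : IsPosDef s) (n : ℕ) : (P s n).natDegree = n :=
  natDegree_eq_of_degree_eq_some (degree_P hs n)

theorem degree_P_lt_succ (hs : IsPosDef s) (n : ℕ) : (P s n).degree < (P s (n + 1)).degree := by
  rw [degree_P hs, degree_P hs]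
  exact_mod_cast n.lt_succ_self

theorem P_zero (hs : IsPosDef s) : P s 0 = C (leadP s 0) := by
  rw [← leadingCoeff_P, leadingCoeff, natDegree_P hs]
  exact eq_C_of_natDegree_eq_zero (natDegree_P hs 0)

theorem Q_zero (hs : IsPosDef s) : Q s 0 = 0 := by
  rw [Q_eq_secondKind, P_zero hs, secondKind_C]

theorem degree_Q_succ (hs : IsPosDef s) (n : ℕ) : (Q s (n + 1)).degree = n := by
  rw [Q_eq_secondKind]
  exact degree_secondKind hs.zero_ne_zero (natDegree_P hs (n + 1))

theorem degree_Q_lt_succ (hs : IsPosDef s) (n : ℕ) : (Q s n).degree < (Q s (n + 1)).degree := by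
  rw [degree_Q_succ hs]
  cases n with
  | zero => rw [Q_zero hs, degree_zero]; exact WithBot.bot_lt_coe 0
  | succ n => rw [degree_Q_succ hs]; exact_mod_cast n.lt_succ_self

theorem momentMap_P_mul_P (hs : IsPosDef s) (n k : ℕ) :
    momentMap s (P s n * P s k) = if n = k then 1 else 0 := by
  have hpos := hs _ (monic_monicOrth s n).ne_zero
  rw [P_eq_C_mul_monicOrth, P_eq_C_mul_monicOrth, mul_mul_mul_comm, ← C_mul, momentMap_C_mul]
  rcases lt_trichotomy n k with hlt | rfl | hlt
  · rw [mul_comm (monicOrth s n), momentMap_monicOrth_mul_of_lt hs hlt, mul_zero, if_neg hlt.ne]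
  · rw [if_pos rfl, leadP, ← mul_inv, Real.mul_self_sqrt hpos.le, inv_mul_cancel₀ hpos.ne']
  · rw [momentMap_monicOrth_mul_of_lt hs hlt, mul_zero, if_neg hlt.ne']

theorem eq_sum_C_mul_P (hs : IsPosDef s) {n : ℕ} {q : ℝ[X]} (hq : q.degree < n) :
    q = ∑ k ∈ Finset.range n, C (momentMap s (q * P s k)) * P s k := by
  let S : Polynomial.Sequence ℝ := ⟨P s, degree_P hs⟩
  have hS : ∀ k < n, IsUnit (S k).leadingCoeff := fun k _ => by
    simp
  rw [← mem_degreeLT, ← S.span_degreeLT hS] at hq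
  induction hq using Submodule.span_induction with
  | mem p hp =>
    obtain ⟨j, hj, rfl⟩ := hp
    change P s j = ∑ k ∈ Finset.range n, C (momentMap s (P s j * P s k)) * P s k
    simp [momentMap_P_mul_P hs, Set.mem_Iio.1 hj]
  | zero => simp
  | add p q _ _ hp hq =>
    conv_lhs => rw [hp, hq]
    simp only [add_mul, map_add, Finset.sum_add_distrib]
  | smul c p _ hp =>
    conv_lhs => rw [hp]
    simp only [smul_eq_C_mul, Finset.mul_sum, mul_assoc, momentMap_C_mul, C_mul]

theorem momentMap_mul_P_of_degree_lt (hs : IsPosDef s) {n : ℕ} {q : ℝ[X]} (hq : q.degree < n) :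
    momentMap s (q * P s n) = 0 := by
  rw [eq_sum_C_mul_P hs hq, Finset.sum_mul, map_sum]
  refine Finset.sum_eq_zero fun k hk => ?_
  rw [mul_assoc, momentMap_C_mul, momentMap_P_mul_P hs, if_neg (Finset.mem_range.1 hk).ne, mul_zero]

theorem momentMap_mul_P_of_degree_eq (hs : IsPosDef s) {n : ℕ} {q : ℝ[X]} (hq : q.degree = n) :
    momentMap s (q * P s n) = q.leadingCoeff / leadP s n := by
  have hlead := (leadP_pos hs n).ne'
  set c := q.leadingCoeff / leadP s n with hc
  have hc0 : c ≠ 0 := div_ne_zero (leadingCoeff_ne_zero.2 (ne_zero_of_degree_gt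
    (n := ⊥) (by rw [hq]; exact WithBot.bot_lt_coe n))) hlead
  have hlt : (q - C c * P s n).degree < n := by
    rw [← hq]
    refine degree_sub_lt_left ?_ (by rintro rfl; simp at hq) ?_
    · rw [degree_C_mul hc0, degree_P hs, hq]
    · rw [leadingCoeff_mul, leadingCoeff_C, leadingCoeff_P, hc, div_mul_cancel₀ _ hlead]
  have := momentMap_mul_P_of_degree_lt hs hlt
  rwa [sub_mul, map_sub, mul_assoc, momentMap_C_mul, momentMap_P_mul_P hs, if_pos rfl, mul_one,
    sub_eq_zero] at this

end OrthonormalPolynomials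

section SummationFormulas

/-- The kernel `P_k(w) Q_n(w) - P_n(w) Q_k(w)` by which `P_n` and `Q_n` at one point are expressed
through their predecessors at another point. -/
def volterraKernel {𝕜 : Type*} [CommRing 𝕜] [Algebra ℝ 𝕜] (s : ℕ → ℝ) (n k : ℕ) (w : 𝕜) : 𝕜 :=
  aeval w (P s k) * aeval w (Q s n) - aeval w (P s n) * aeval w (Q s k)

theorem momentMap_P_divByMonic_mul_P (hs : IsPosDef s) {n k : ℕ} (hk : k < n) (w : ℝ) :
    momentMap s (P s n /ₘ (X - C w) * P s k) = volterraKernel s n k w := by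
  have hdeg : (P s k /ₘ (X - C w)).degree < n :=
    (degree_divByMonic_X_sub_C_lt (degree_P hs k).le w).trans (by exact_mod_cast hk)
  have := momentMap_divByMonic_mul_sub s (P s n) (P s k) w
  rw [mul_comm (P s n), momentMap_mul_P_of_degree_lt hs hdeg, sub_zero] at this
  simpa only [volterraKernel, Q_eq_secondKind, coe_aeval_eq_eval] using this

theorem P_divByMonic_eq_sum (hs : IsPosDef s) (n : ℕ) (w : ℝ) :
    P s n /ₘ (X - C w) = ∑ k ∈ Finset.range n, C (volterraKernel s n k w) * P s k := by
  conv_lhs => rw [eq_sum_C_mul_P hs (degree_divByMonic_X_sub_C_lt (degree_P hs n).le w)]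
  refine Finset.sum_congr rfl fun k hk => ?_
  rw [momentMap_P_divByMonic_mul_P hs (Finset.mem_range.1 hk)]

theorem P_eq_sum_volterraKernel (hs : IsPosDef s) (n : ℕ) (w : ℝ) :
    P s n = C ((P s n).eval w) +
      (X - C w) * ∑ k ∈ Finset.range n, C (volterraKernel s n k w) * P s k := by
  rw [← P_divByMonic_eq_sum hs, add_comm, X_sub_C_mul_divByMonic_add]

theorem Q_eq_sum_volterraKernel (hs : IsPosDef s) (n : ℕ) (w : ℝ) :
    Q s n = C ((Q s n).eval w) +
      (X - C w) * ∑ k ∈ Finset.range n, C (volterraKernel s n k w) * Q s k := by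
  have hsum : secondKind s (P s n /ₘ (X - C w)) =
      ∑ k ∈ Finset.range n, C (volterraKernel s n k w) * Q s k := by
    simp only [P_divByMonic_eq_sum hs, map_sum, secondKind_C_mul, Q_eq_secondKind]
  rw [← hsum, Q_eq_secondKind, ← momentMap_divByMonic_X_sub_C, add_comm, ← secondKind_X_sub_C_mul,
    ← add_zero (secondKind s (_ * _)), ← secondKind_C s ((P s n).eval w), ← map_add,
    X_sub_C_mul_divByMonic_add]

theorem volterraKernel_succ_pos (hs : IsPosDef s) (n : ℕ) (w : ℝ) :
    0 < volterraKernel s (n + 1) n w := by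
  have hP := degree_P hs (n + 1)
  have hdeg : (P s (n + 1) /ₘ (X - C w)).degree = n := by
    have := degree_add_divByMonic (monic_X_sub_C w)
      (show (X - C w).degree ≤ (P s (n + 1)).degree by
        rw [hP, degree_X_sub_C]; exact_mod_cast n.succ_pos)
    rw [hP, degree_X_sub_C, Nat.cast_succ, add_comm] at this
    exact WithBot.add_right_cancel WithBot.one_ne_bot this
  rw [← momentMap_P_divByMonic_mul_P hs n.lt_succ_self, momentMap_mul_P_of_degree_eq hs hdeg,
    leadingCoeff_divByMonic_X_sub_C _ (by rw [hP]; exact_mod_cast n.succ_ne_zero), leadingCoeff_P]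
  exact div_pos (leadP_pos hs _) (leadP_pos hs _)

variable {𝕜 : Type*} [RCLike 𝕜]

theorem aeval_ofReal (p : ℝ[X]) (x : ℝ) : aeval (x : 𝕜) p = ((p.eval x : ℝ) : 𝕜) := by
  simpa using aeval_algebraMap_apply 𝕜 x p

theorem volterraKernel_ofReal (s : ℕ → ℝ) (n k : ℕ) (w : ℝ) :
    volterraKernel s n k (w : 𝕜) = ((volterraKernel s n k w : ℝ) : 𝕜) := by
  simp [volterraKernel, aeval_ofReal]

theorem eval_eq_eval_of_forall_ofReal {p q : 𝕜[X]}
    (h : ∀ x : ℝ, p.eval (x : 𝕜) = q.eval (x : 𝕜)) (w : 𝕜) : p.eval w = q.eval w := by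
  refine congrArg (eval w) (eq_of_infinite_eval_eq p q ?_)
  refine (Set.infinite_range_of_injective (RCLike.ofReal_injective (K := 𝕜))).mono ?_
  rintro _ ⟨x, rfl⟩
  exact h x

/- Both sides are polynomials in `w`, so it is enough to know the formula for real `w`. -/
theorem aeval_eq_sum_of_forall_real {R : ℕ → ℝ[X]} {n : ℕ}
    (hR : ∀ w : ℝ, R n = C ((R n).eval w) +
      (X - C w) * ∑ k ∈ Finset.range n, C (volterraKernel s n k w) * R k) (z w : 𝕜) :
    aeval z (R n) = aeval w (R n) +
      (z - w) * ∑ k ∈ Finset.range n, volterraKernel s n k w * aeval z (R k) := by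
  let ι : ℝ[X] → 𝕜[X] := map (algebraMap ℝ 𝕜)
  let rhs : 𝕜[X] := ι (R n) + (C z - X) * ∑ k ∈ Finset.range n,
    (ι (P s k) * ι (Q s n) - ι (P s n) * ι (Q s k)) * C (aeval z (R k))
  have eval_rhs (u : 𝕜) : rhs.eval u = aeval u (R n) +
      (z - u) * ∑ k ∈ Finset.range n, volterraKernel s n k u * aeval z (R k) := by
    simp [rhs, ι, volterraKernel, eval_finsetSum, eval_map_algebraMap]
  suffices ∀ x : ℝ, (C (aeval z (R n))).eval (x : 𝕜) = rhs.eval (x : 𝕜) by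
    simpa only [eval_C, eval_rhs] using eval_eq_eval_of_forall_ofReal this w
  intro x
  rw [eval_rhs, eval_C]
  conv_lhs => rw [hR x]
  simp [volterraKernel_ofReal, aeval_ofReal]

theorem aeval_P_eq_sum (hs : IsPosDef s) (n : ℕ) (z w : 𝕜) :
    aeval z (P s n) = aeval w (P s n) +
      (z - w) * ∑ k ∈ Finset.range n, volterraKernel s n k w * aeval z (P s k) :=
  aeval_eq_sum_of_forall_real (P_eq_sum_volterraKernel hs n) z w

theorem aeval_Q_eq_sum (hs : IsPosDef s) (n : ℕ) (z w : 𝕜) :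
    aeval z (Q s n) = aeval w (Q s n) +
      (z - w) * ∑ k ∈ Finset.range n, volterraKernel s n k w * aeval z (Q s k) :=
  aeval_eq_sum_of_forall_real (Q_eq_sum_volterraKernel hs n) z w

end SummationFormulas

/-! ### Square summability at a non-real point -/

section StieltjesTransform

theorem ofReal_sub_ne_zero {z : ℂ} (hz : z.im ≠ 0) (x : ℝ) : (x : ℂ) - z ≠ 0 := fun h => by
  simpa using hz (by simpa using congrArg Complex.im h)

theorem norm_inv_ofReal_sub_le {z : ℂ} (hz : z.im ≠ 0) (x : ℝ) :
    ‖((x : ℂ) - z)⁻¹‖ ≤ |z.im|⁻¹ := by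
  rw [norm_inv]
  exact inv_anti₀ (abs_pos.2 hz) (by simpa using Complex.abs_im_le_norm ((x : ℂ) - z))

/-- The function `x ↦ 1 / (x - z)` on the real line, for non-real `z`; its integral is the
Stieltjes transform at `z`. -/
def cauchyKernel {z : ℂ} (hz : z.im ≠ 0) : BoundedContinuousFunction ℝ ℂ :=
  .ofNormedAddCommGroup (fun x : ℝ => ((x : ℂ) - z)⁻¹)
    (Continuous.inv₀ (by fun_prop) (ofReal_sub_ne_zero hz)) |z.im|⁻¹ (norm_inv_ofReal_sub_le hz)

@[simp]
theorem cauchyKernel_apply {z : ℂ} (hz : z.im ≠ 0) (x : ℝ) :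
    cauchyKernel hz x = ((x : ℂ) - z)⁻¹ := rfl

theorem cauchyKernel_mul_cauchyKernel {z w : ℂ} (hz : z.im ≠ 0) (hw : w.im ≠ 0) (hzw : z ≠ w) :
    cauchyKernel hz * cauchyKernel hw = (z - w)⁻¹ • (cauchyKernel hz - cauchyKernel hw) := by
  ext x
  have hxz := ofReal_sub_ne_zero hz x
  have hxw := ofReal_sub_ne_zero hw x
  have hzw := sub_ne_zero.2 hzw
  simp only [BoundedContinuousFunction.coe_mul, Pi.mul_apply, cauchyKernel_apply,
    BoundedContinuousFunction.coe_smul, BoundedContinuousFunction.coe_sub, Pi.sub_apply,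
    smul_eq_mul]
  field_simp
  ring

/-- The closed span of the constants and all functions `1 / (x - z)`. It turns out to be closed
under multiplication by each of these functions. -/
def cauchySpan : Submodule ℂ (BoundedContinuousFunction ℝ ℂ) :=
  (Submodule.span ℂ
    (insert 1 {f | ∃ (z : ℂ) (hz : z.im ≠ 0), cauchyKernel hz = f})).topologicalClosure

theorem one_mem_cauchySpan : 1 ∈ cauchySpan :=
  Submodule.le_topologicalClosure _ (Submodule.subset_span (Set.mem_insert _ _))

theorem cauchyKernel_mem_cauchySpan {z : ℂ} (hz : z.im ≠ 0) : cauchyKernel hz ∈ cauchySpan :=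
  Submodule.le_topologicalClosure _
    (Submodule.subset_span (Set.mem_insert_of_mem _ ⟨z, hz, rfl⟩))

theorem im_add_one_div_ne_zero {z : ℂ} (hz : z.im ≠ 0) (n : ℕ) :
    (z + (1 / ((n : ℝ) + 1) : ℝ)).im ≠ 0 := by
  simpa using hz

theorem tendsto_cauchyKernel_add {z : ℂ} (hz : z.im ≠ 0) :
    Tendsto (fun n : ℕ => cauchyKernel (im_add_one_div_ne_zero hz n)) atTop
      (𝓝 (cauchyKernel hz)) := by
  rw [tendsto_iff_norm_sub_tendsto_zero]
  have hlim : Tendsto (fun n : ℕ => (1 / ((n : ℝ) + 1)) * (|z.im|⁻¹ * |z.im|⁻¹)) atTop (𝓝 0) := by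
    simpa using tendsto_one_div_add_atTop_nhds_zero_nat.mul_const (|z.im|⁻¹ * |z.im|⁻¹)
  refine squeeze_zero (fun n => norm_nonneg _) (fun n => ?_) hlim
  rw [BoundedContinuousFunction.norm_le (by positivity)]
  intro x
  set t : ℝ := 1 / ((n : ℝ) + 1)
  have hz' : (z + t).im ≠ 0 := im_add_one_div_ne_zero hz n
  have hsub : ((x : ℂ) - (z + t))⁻¹ - ((x : ℂ) - z)⁻¹ =
      t * (((x : ℂ) - (z + t))⁻¹ * ((x : ℂ) - z)⁻¹) := by
    rw [inv_sub_inv (ofReal_sub_ne_zero hz' x) (ofReal_sub_ne_zero hz x), ← mul_inv, div_eq_mul_inv]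
    ring
  change ‖((x : ℂ) - (z + t))⁻¹ - ((x : ℂ) - z)⁻¹‖ ≤ _
  rw [hsub, norm_mul, norm_mul, Complex.norm_of_nonneg (by positivity)]
  gcongr
  · simpa using norm_inv_ofReal_sub_le hz' x
  · exact norm_inv_ofReal_sub_le hz x

theorem cauchyKernel_mul_mem_cauchySpan {z : ℂ} (hz : z.im ≠ 0) {f : BoundedContinuousFunction ℝ ℂ}
    (hf : f ∈ cauchySpan) : cauchyKernel hz * f ∈ cauchySpan := by
  have mul_of_ne {w : ℂ} (hw : w.im ≠ 0) (hzw : z ≠ w) :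
      cauchyKernel hz * cauchyKernel hw ∈ cauchySpan := by
    rw [cauchyKernel_mul_cauchyKernel hz hw hzw]
    exact Submodule.smul_mem _ _ (Submodule.sub_mem _ (cauchyKernel_mem_cauchySpan hz)
      (cauchyKernel_mem_cauchySpan hw))
  have mul_self : cauchyKernel hz * cauchyKernel hz ∈ cauchySpan := by
    refine (Submodule.isClosed_topologicalClosure _).mem_of_tendsto
      ((tendsto_cauchyKernel_add hz).const_mul (cauchyKernel hz))
      (Eventually.of_forall fun n => mul_of_ne _ fun h => ?_)
    exact Nat.cast_add_one_ne_zero (R := ℂ) n (by simpa using h)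
  let L : BoundedContinuousFunction ℝ ℂ →L[ℂ] BoundedContinuousFunction ℝ ℂ :=
    ContinuousLinearMap.mul ℂ _ (cauchyKernel hz)
  suffices h : cauchySpan ≤ cauchySpan.comap L.toLinearMap from h hf
  refine Submodule.topologicalClosure_minimal _ (Submodule.span_le.2 ?_)
    ((Submodule.isClosed_topologicalClosure _).preimage L.continuous)
  rintro _ (rfl | ⟨w, hw, rfl⟩)
  · simpa [L] using cauchyKernel_mem_cauchySpan hz
  · rcases eq_or_ne z w with rfl | hzw
    exacts [mul_self, mul_of_ne hw hzw]

theorem adjoin_cauchyKernel_le_cauchySpan {z : ℂ} (hz : z.im ≠ 0)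
    {f : BoundedContinuousFunction ℝ ℂ} (hf : f ∈ StarAlgebra.adjoin ℂ {cauchyKernel hz}) :
    f ∈ cauchySpan := by
  suffices h : ∀ g ∈ cauchySpan, f * g ∈ cauchySpan by simpa using h 1 one_mem_cauchySpan
  rw [← StarSubalgebra.mem_toSubalgebra, StarAlgebra.adjoin_toSubalgebra] at hf
  induction hf using Algebra.adjoin_induction with
  | mem f hf =>
    intro g hg
    rcases hf with rfl | hf
    · exact cauchyKernel_mul_mem_cauchySpan hz hg
    · have hconj : (starRingEnd ℂ z).im ≠ 0 := by simpa using hz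
      have : f = cauchyKernel hconj := by
        rw [← star_star f, Set.mem_singleton_iff.1 (Set.mem_star.1 hf)]
        ext x
        simp
      exact this ▸ cauchyKernel_mul_mem_cauchySpan hconj hg
  | algebraMap c =>
    intro g hg
    simpa [Algebra.algebraMap_eq_smul_one] using cauchySpan.smul_mem c hg
  | add f₁ f₂ _ _ h₁ h₂ => exact fun g hg => by simpa [add_mul] using add_mem (h₁ g hg) (h₂ g hg)
  | mul f₁ f₂ _ _ h₁ h₂ => exact fun g hg => by simpa [mul_assoc] using h₁ _ (h₂ g hg)

theorem continuous_integral_boundedContinuousFunction (μ : Measure ℝ) [IsProbabilityMeasure μ] :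
    Continuous fun f : BoundedContinuousFunction ℝ ℂ => ∫ x, f x ∂μ := by
  refine (LipschitzWith.of_dist_le_mul (K := 1) fun f g => ?_).continuous
  rw [dist_eq_norm, dist_eq_norm, ← integral_sub (f.integrable μ) (g.integrable μ),
    NNReal.coe_one, one_mul]
  exact (f - g).norm_integral_le_norm μ

theorem integral_eq_of_mem_cauchySpan {μ ν : Measure ℝ} [IsProbabilityMeasure μ]
    [IsProbabilityMeasure ν]
    (h : ∀ z : ℂ, z.im ≠ 0 → ∫ x : ℝ, ((x : ℂ) - z)⁻¹ ∂μ = ∫ x : ℝ, ((x : ℂ) - z)⁻¹ ∂ν)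
    {f : BoundedContinuousFunction ℝ ℂ} (hf : f ∈ cauchySpan) : ∫ x, f x ∂μ = ∫ x, f x ∂ν := by
  have hclosed : IsClosed {f : BoundedContinuousFunction ℝ ℂ | ∫ x, f x ∂μ = ∫ x, f x ∂ν} :=
    isClosed_eq (continuous_integral_boundedContinuousFunction μ)
      (continuous_integral_boundedContinuousFunction ν)
  refine closure_minimal (fun f hf => ?_) hclosed hf
  change ∫ x, f x ∂μ = ∫ x, f x ∂ν
  induction hf using Submodule.span_induction with
  | mem f hf =>
    rcases hf with rfl | ⟨z, hz, rfl⟩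
    · simp
    · exact h z hz
  | zero => simp
  | add f g _ _ hf hg =>
    simp only [BoundedContinuousFunction.coe_add, Pi.add_apply]
    rw [integral_add (f.integrable μ) (g.integrable μ), integral_add (f.integrable ν)
      (g.integrable ν), hf, hg]
  | smul c f _ hf =>
    simp only [BoundedContinuousFunction.coe_smul, integral_smul, hf]

theorem measure_eq_of_integral_inv_ofReal_sub_eq {μ ν : Measure ℝ} [IsProbabilityMeasure μ]
    [IsProbabilityMeasure ν]
    (h : ∀ z : ℂ, z.im ≠ 0 → ∫ x : ℝ, ((x : ℂ) - z)⁻¹ ∂μ = ∫ x : ℝ, ((x : ℂ) - z)⁻¹ ∂ν) :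
    μ = ν := by
  have hI : Complex.I.im ≠ 0 := by simp
  refine ext_of_forall_mem_subalgebra_integral_eq_of_pseudoEMetric_complete_countable (𝕜 := ℂ)
    (A := StarAlgebra.adjoin ℂ {cauchyKernel hI}) (fun x y hxy => ?_)
    fun f hf => integral_eq_of_mem_cauchySpan h (adjoin_cauchyKernel_le_cauchySpan hI hf)
  refine ⟨cauchyKernel hI, ⟨_, ⟨_, StarAlgebra.self_mem_adjoin_singleton ℂ _, rfl⟩, rfl⟩,
    fun he => ?_⟩
  simp only [cauchyKernel_apply] at he
  exact hxy (by simpa using he)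

end StieltjesTransform

section SquareSummable

open scoped ComplexConjugate InnerProductSpace

theorem IsSolution.integrable_eval_mul_inv {μ : Measure ℝ} (hμ : IsSolution s μ) {z : ℂ}
    (hz : z.im ≠ 0) (p : ℝ[X]) :
    Integrable (fun x : ℝ => ((p.eval x : ℝ) : ℂ) * ((x : ℂ) - z)⁻¹) μ :=
  (hμ.integrable_eval p).ofReal.mul_bdd (c := |z.im|⁻¹)
    (cauchyKernel hz).continuous.aestronglyMeasurable
    (Eventually.of_forall (norm_inv_ofReal_sub_le hz))

theorem IsSolution.integral_eval_mul_inv {μ : Measure ℝ} (hμ : IsSolution s μ) {z : ℂ}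
    (hz : z.im ≠ 0) (p : ℝ[X]) :
    ∫ x : ℝ, ((p.eval x : ℝ) : ℂ) * ((x : ℂ) - z)⁻¹ ∂μ =
      (∫ x : ℝ, ((x : ℂ) - z)⁻¹ ∂μ) * aeval z p + aeval z (secondKind s p) := by
  have hint := hμ.integrable_eval_mul_inv hz
  induction p using Polynomial.induction_on with
  | C a =>
    simp only [eval_C, secondKind_C, map_zero, add_zero, aeval_C, Complex.coe_algebraMap]
    rw [integral_const_mul, mul_comm]
  | add p q hp hq =>
    simp only [eval_add, Complex.ofReal_add, add_mul, map_add]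
    rw [integral_add (hint p) (hint q), hp, hq]
    ring
  | monomial n a ih =>
    rw [show C a * X ^ (n + 1) = X * (C a * X ^ n) by ring]
    set p := C a * X ^ n
    have heq (x : ℝ) : (((X * p).eval x : ℝ) : ℂ) * ((x : ℂ) - z)⁻¹ =
        z * (((p.eval x : ℝ) : ℂ) * ((x : ℂ) - z)⁻¹) + ((p.eval x : ℝ) : ℂ) := by
      have := ofReal_sub_ne_zero hz x
      simp only [eval_mul, eval_X, Complex.ofReal_mul]
      field_simp
      ring
    have hp : Integrable (fun x : ℝ => ((p.eval x : ℝ) : ℂ)) μ := (hμ.integrable_eval p).ofReal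
    simp_rw [heq]
    rw [integral_add ((hint p).const_mul z) hp, integral_const_mul, ih,
      integral_complex_ofReal, hμ.integral_eval, secondKind_X_mul]
    simp only [map_mul, map_add, aeval_X, aeval_C, Complex.coe_algebraMap]
    ring

theorem IsSolution.memLp_eval {μ : Measure ℝ} (hμ : IsSolution s μ) (p : ℝ[X]) :
    MemLp (fun x : ℝ => ((p.eval x : ℝ) : ℂ)) 2 μ := by
  refine ((memLp_two_iff_integrable_sq p.continuous.aestronglyMeasurable).2 ?_).ofReal
  simpa [pow_two] using hμ.integrable_eval (p * p)

theorem inner_toLp_ofReal {μ : Measure ℝ} {f : ℝ → ℝ} {g : ℝ → ℂ}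
    (hf : MemLp (fun x => (f x : ℂ)) 2 μ) (hg : MemLp g 2 μ) :
    ⟪hf.toLp, hg.toLp⟫_ℂ = ∫ x, f x * g x ∂μ := by
  rw [L2.inner_def]
  refine integral_congr_ae ?_
  filter_upwards [hf.coeFn_toLp, hg.coeFn_toLp] with x hfx hgx
  rw [hfx, hgx, RCLike.inner_apply, Complex.conj_ofReal, mul_comm]

theorem IsSolution.orthonormal_P {μ : Measure ℝ} (hμ : IsSolution s μ) (hs : IsPosDef s) :
    Orthonormal ℂ fun n => (hμ.memLp_eval (P s n)).toLp := by
  rw [orthonormal_iff_ite]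
  intro n k
  rw [inner_toLp_ofReal]
  simp_rw [← Complex.ofReal_mul, ← eval_mul]
  rw [integral_complex_ofReal, hμ.integral_eval, momentMap_P_mul_P hs]
  split_ifs <;> simp

theorem IsSolution.summable_transform {μ : Measure ℝ} (hμ : IsSolution s μ) (hs : IsPosDef s)
    {z : ℂ} (hz : z.im ≠ 0) :
    Summable fun k => ‖(∫ x : ℝ, ((x : ℂ) - z)⁻¹ ∂μ) * aeval z (P s k) + aeval z (Q s k)‖ ^ 2 := by
  have := hμ.prob
  have hmem : MemLp (cauchyKernel hz) 2 μ :=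
    MemLp.of_bound (cauchyKernel hz).continuous.aestronglyMeasurable |z.im|⁻¹
      (Eventually.of_forall (norm_inv_ofReal_sub_le hz))
  refine ((hμ.orthonormal_P hs).inner_products_summable hmem.toLp).congr fun k => ?_
  rw [inner_toLp_ofReal, Q_eq_secondKind]
  exact congrArg (‖·‖ ^ 2) (hμ.integral_eval_mul_inv hz (P s k))

theorem IsIndeterminate.exists_integral_inv_ne (h : IsIndeterminate s) :
    ∃ (μ ν : Measure ℝ) (z : ℂ), IsSolution s μ ∧ IsSolution s ν ∧ z.im ≠ 0 ∧
      ∫ x : ℝ, ((x : ℂ) - z)⁻¹ ∂μ ≠ ∫ x : ℝ, ((x : ℂ) - z)⁻¹ ∂ν := by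
  obtain ⟨μ, ν, hμ, hν, hne⟩ := h
  have := hμ.prob
  have := hν.prob
  by_contra! hcon
  exact hne (measure_eq_of_integral_inv_ofReal_sub_eq fun z hz => hcon μ ν z hμ hν hz)

theorem IsIndeterminate.exists_summable_norm_sq (h : IsIndeterminate s) :
    ∃ z : ℂ, (Summable fun k => ‖aeval z (P s k)‖ ^ 2) ∧
      Summable fun k => ‖aeval z (Q s k)‖ ^ 2 := by
  have memℓp_iff (u : ℕ → ℂ) : Memℓp u 2 ↔ Summable fun k => ‖u k‖ ^ 2 := by
    simpa using memℓp_gen_iff (p := 2) (f := u) (by simp)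
  obtain ⟨μ, ν, z, hμ, hν, hz, hne⟩ := h.exists_integral_inv_ne
  have hμt := (memℓp_iff _).2 (hμ.summable_transform h.isPosDef hz)
  have hνt := (memℓp_iff _).2 (hν.summable_transform h.isPosDef hz)
  set a := ∫ x : ℝ, ((x : ℂ) - z)⁻¹ ∂μ
  set b := ∫ x : ℝ, ((x : ℂ) - z)⁻¹ ∂ν
  have hP : Memℓp (fun k => aeval z (P s k)) 2 := by
    convert (hμt.sub hνt).const_smul (a - b)⁻¹ using 1
    ext k
    have := sub_ne_zero.2 hne
    simp only [Pi.smul_apply, Pi.sub_apply, smul_eq_mul]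
    field_simp
    ring
  have hQ : Memℓp (fun k => aeval z (Q s k)) 2 := by
    convert hμt.sub (hP.const_smul a) using 1
    ext k
    simp
  exact ⟨z, (memℓp_iff _).1 hP, (memℓp_iff _).1 hQ⟩

end SquareSummable

/-! ### Growth of `P_n` and `Q_n` -/

section Growth

variable {𝕜 : Type*} [RCLike 𝕜]

/-- The quantity `|P_n(w)| + |Q_n(w)|`, which controls the growth of `P_n` and `Q_n` simultaneously
because both solve the same Volterra equation with a kernel dominated by it. -/
def pairNorm (s : ℕ → ℝ) (w : 𝕜) (n : ℕ) : ℝ :=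
  ‖aeval w (P s n)‖ + ‖aeval w (Q s n)‖

theorem pairNorm_nonneg (s : ℕ → ℝ) (w : 𝕜) (n : ℕ) : 0 ≤ pairNorm s w n := by
  unfold pairNorm
  positivity

theorem norm_aeval_P_le_pairNorm (s : ℕ → ℝ) (w : 𝕜) (n : ℕ) :
    ‖aeval w (P s n)‖ ≤ pairNorm s w n :=
  le_add_of_nonneg_right (norm_nonneg _)

theorem norm_aeval_Q_le_pairNorm (s : ℕ → ℝ) (w : 𝕜) (n : ℕ) :
    ‖aeval w (Q s n)‖ ≤ pairNorm s w n :=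
  le_add_of_nonneg_left (norm_nonneg _)

theorem pairNorm_ofReal (s : ℕ → ℝ) (x : ℝ) (n : ℕ) :
    pairNorm s (x : 𝕜) n = pairNorm s x n := by
  simp only [pairNorm, aeval_ofReal, RCLike.norm_ofReal, coe_aeval_eq_eval, Real.norm_eq_abs]

theorem norm_volterraKernel_le (s : ℕ → ℝ) (n k : ℕ) (w : 𝕜) :
    ‖volterraKernel s n k w‖ ≤ pairNorm s w n * pairNorm s w k := by
  unfold volterraKernel pairNorm
  refine (norm_sub_le _ _).trans ?_
  rw [norm_mul, norm_mul]
  nlinarith [mul_nonneg (norm_nonneg (aeval w (P s n))) (norm_nonneg (aeval w (P s k))),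
    mul_nonneg (norm_nonneg (aeval w (Q s n))) (norm_nonneg (aeval w (Q s k)))]

theorem norm_add_mul_sum_volterraKernel_le (s : ℕ → ℝ) (z w c : 𝕜) (n : ℕ) (u : ℕ → 𝕜) :
    ‖c + (z - w) * ∑ k ∈ Finset.range n, volterraKernel s n k w * u k‖ ≤
      ‖c‖ + ‖z - w‖ * (pairNorm s w n * ∑ k ∈ Finset.range n, pairNorm s w k * ‖u k‖) := by
  refine (norm_add_le _ _).trans ?_
  rw [norm_mul, Finset.mul_sum]
  gcongr
  refine norm_sum_le_of_le _ fun k _ => ?_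
  rw [norm_mul, ← mul_assoc]
  gcongr
  exact norm_volterraKernel_le s n k w

theorem pairNorm_le_mul_one_add_sum (hs : IsPosDef s) (z w : 𝕜) (n : ℕ) :
    pairNorm s z n ≤ pairNorm s w n *
      (1 + ‖z - w‖ * ∑ k ∈ Finset.range n, pairNorm s w k * pairNorm s z k) := by
  have hP := norm_add_mul_sum_volterraKernel_le s z w (aeval w (P s n)) n fun k => aeval z (P s k)
  have hQ := norm_add_mul_sum_volterraKernel_le s z w (aeval w (Q s n)) n fun k => aeval z (Q s k)
  rw [← aeval_P_eq_sum hs] at hP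
  rw [← aeval_Q_eq_sum hs] at hQ
  refine (add_le_add hP hQ).trans_eq ?_
  conv_rhs => enter [2, 2, 2, 2, k]; rw [pairNorm.eq_def s z, mul_add]
  rw [Finset.sum_add_distrib, pairNorm]
  ring

theorem le_mul_prod_of_le_mul_one_add_sum {d x : ℕ → ℝ} (hd : ∀ n, 0 ≤ d n) {r : ℝ} (hr : 0 ≤ r)
    (hx : ∀ n, x n ≤ d n * (1 + r * ∑ k ∈ Finset.range n, d k * x k)) (n : ℕ) :
    x n ≤ d n * ∏ k ∈ Finset.range n, (1 + r * d k ^ 2) := by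
  suffices key : 1 + r * ∑ k ∈ Finset.range n, d k * x k ≤
      ∏ k ∈ Finset.range n, (1 + r * d k ^ 2) from
    (hx n).trans (mul_le_mul_of_nonneg_left key (hd n))
  induction n with
  | zero => simp
  | succ n ih =>
    rw [Finset.sum_range_succ, Finset.prod_range_succ]
    calc 1 + r * (∑ k ∈ Finset.range n, d k * x k + d n * x n)
        ≤ 1 + r * (∑ k ∈ Finset.range n, d k * x k +
          d n * (d n * (1 + r * ∑ k ∈ Finset.range n, d k * x k))) := by
          gcongr
          exacts [hd n, hx n]
      _ = (1 + r * ∑ k ∈ Finset.range n, d k * x k) * (1 + r * d n ^ 2) := by ring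
      _ ≤ _ := by gcongr

theorem pairNorm_le_mul_prod (hs : IsPosDef s) (z w : 𝕜) (n : ℕ) :
    pairNorm s z n ≤ pairNorm s w n *
      ∏ k ∈ Finset.range n, (1 + ‖z - w‖ * pairNorm s w k ^ 2) :=
  le_mul_prod_of_le_mul_one_add_sum (pairNorm_nonneg s w) (norm_nonneg _)
    (pairNorm_le_mul_one_add_sum hs z w) n

theorem prod_one_add_mul_le_exp {r : ℝ} (hr : 0 ≤ r) {e : ℕ → ℝ} (he : ∀ k, 0 ≤ e k)
    (hsum : Summable e) (t : Finset ℕ) :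
    ∏ k ∈ t, (1 + r * e k) ≤ Real.exp (r * ∑' k, e k) := by
  calc ∏ k ∈ t, (1 + r * e k) ≤ Real.exp (∑ k ∈ t, r * e k) :=
        Real.prod_one_add_le_exp_sum _ fun k => mul_nonneg hr (he k)
    _ ≤ Real.exp (r * ∑' k, e k) := by
        rw [← Finset.mul_sum]
        have := hsum.sum_le_tsum t fun k _ => he k
        gcongr

theorem pairNorm_le_mul_exp (hs : IsPosDef s) {w : 𝕜}
    (hw : Summable fun n => pairNorm s w n ^ 2) {z : 𝕜} {r : ℝ} (hz : ‖z - w‖ ≤ r) (n : ℕ) :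
    pairNorm s z n ≤ pairNorm s w n * Real.exp (r * ∑' k, pairNorm s w k ^ 2) := by
  refine (pairNorm_le_mul_prod hs z w n).trans ?_
  refine mul_le_mul_of_nonneg_left ?_ (pairNorm_nonneg s w n)
  refine (prod_one_add_mul_le_exp (norm_nonneg _) (fun k => sq_nonneg _) hw _).trans ?_
  have : 0 ≤ ∑' k, pairNorm s w k ^ 2 := tsum_nonneg fun k => sq_nonneg _
  gcongr

theorem summable_pairNorm_sq_of_summable (hs : IsPosDef s) {w : 𝕜}
    (hw : Summable fun n => pairNorm s w n ^ 2) (z : 𝕜) :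
    Summable fun n => pairNorm s z n ^ 2 := by
  refine Summable.of_nonneg_of_le (fun _ => sq_nonneg _) (fun n => ?_)
    (hw.mul_right (Real.exp (‖z - w‖ * ∑' k, pairNorm s w k ^ 2) ^ 2))
  rw [← mul_pow]
  exact pow_le_pow_left₀ (pairNorm_nonneg s z n) (pairNorm_le_mul_exp hs hw le_rfl n) 2

theorem IsIndeterminate.summable_pairNorm_sq (h : IsIndeterminate s) (z : 𝕜) :
    Summable fun n => pairNorm s z n ^ 2 := by
  obtain ⟨w, hP, hQ⟩ := h.exists_summable_norm_sq
  have hw : Summable fun n => pairNorm s w n ^ 2 :=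
    Summable.of_nonneg_of_le (fun _ => sq_nonneg _) (fun _ => add_sq_le)
      ((hP.add hQ).mul_left 2)
  have h0 : Summable fun n => pairNorm s (0 : ℝ) n ^ 2 :=
    (summable_pairNorm_sq_of_summable h.isPosDef hw ((0 : ℝ) : ℂ)).congr fun n =>
      congrArg (· ^ 2) (pairNorm_ofReal s 0 n)
  refine summable_pairNorm_sq_of_summable h.isPosDef (w := ((0 : ℝ) : 𝕜)) ?_ z
  simpa only [pairNorm_ofReal] using h0

theorem summable_norm_sq_of_le_pairNorm (h : IsIndeterminate s) {T : ℕ → ℝ[X]} {w : 𝕜}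
    (hT : ∀ n, ‖aeval w (T n)‖ ≤ pairNorm s w n) : Summable fun n => ‖aeval w (T n)‖ ^ 2 :=
  Summable.of_nonneg_of_le (fun _ => sq_nonneg _)
    (fun n => pow_le_pow_left₀ (norm_nonneg _) (hT n) 2) (h.summable_pairNorm_sq w)

theorem norm_aeval_mul_le (h : IsIndeterminate s) {R : ℕ → ℝ[X]} {c : ℕ → 𝕜} {z : 𝕜}
    (hR : ∀ n, ‖aeval z (R n)‖ ≤ pairNorm s z n) {r : ℝ} (hz : ‖z‖ ≤ r) (n : ℕ) :
    ‖aeval z (R n) * c n‖ ≤ (pairNorm s (0 : 𝕜) n ^ 2 + ‖c n‖ ^ 2) *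
      Real.exp (r * ∑' k, pairNorm s (0 : 𝕜) k ^ 2) := by
  have hexp := pairNorm_le_mul_exp h.isPosDef (h.summable_pairNorm_sq (0 : 𝕜)) (z := z) (r := r)
    (by simpa using hz) n
  set E := Real.exp (r * ∑' k, pairNorm s (0 : 𝕜) k ^ 2)
  calc ‖aeval z (R n) * c n‖ ≤ (pairNorm s (0 : 𝕜) n * E) * ‖c n‖ := by
        rw [norm_mul]
        gcongr
        exact (hR n).trans hexp
    _ = (pairNorm s (0 : 𝕜) n * ‖c n‖) * E := by ring
    _ ≤ _ := by
        gcongr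
        nlinarith [sq_nonneg (pairNorm s (0 : 𝕜) n - ‖c n‖), sq_nonneg (pairNorm s (0 : 𝕜) n),
          sq_nonneg ‖c n‖]

theorem summable_aeval_mul (h : IsIndeterminate s) {R : ℕ → ℝ[X]} {c : ℕ → 𝕜} {z : 𝕜}
    (hR : ∀ n, ‖aeval z (R n)‖ ≤ pairNorm s z n) (hc : Summable fun n => ‖c n‖ ^ 2) :
    Summable fun n => aeval z (R n) * c n :=
  .of_norm_bounded (((h.summable_pairNorm_sq (0 : 𝕜)).add hc).mul_right _)
    (norm_aeval_mul_le h hR le_rfl)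

theorem continuous_tsum_aeval_mul (h : IsIndeterminate s) {R : ℕ → ℝ[X]} {c : ℕ → 𝕜}
    (hR : ∀ z n, ‖aeval (z : 𝕜) (R n)‖ ≤ pairNorm s z n) (hc : Summable fun n => ‖c n‖ ^ 2) :
    Continuous fun z => ∑' n, aeval z (R n) * c n := by
  refine continuous_iff_continuousAt.2 fun z => ?_
  have hcont : ContinuousOn (fun z : 𝕜 => ∑' n, aeval z (R n) * c n)
      (Metric.ball 0 (‖z‖ + 1)) :=
    continuousOn_tsum (fun n => ((R n).continuous_aeval.mul continuous_const).continuousOn)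
      (((h.summable_pairNorm_sq (0 : 𝕜)).add hc).mul_right _)
      fun n x hx => norm_aeval_mul_le h (hR x) (mem_ball_zero_iff.1 hx).le n
  exact hcont.continuousAt (Metric.isOpen_ball.mem_nhds (by simp))

theorem differentiable_tsum_aeval_mul (h : IsIndeterminate s) {R : ℕ → ℝ[X]} {c : ℕ → ℂ}
    (hR : ∀ z n, ‖aeval (z : ℂ) (R n)‖ ≤ pairNorm s z n) (hc : Summable fun n => ‖c n‖ ^ 2) :
    Differentiable ℂ fun z => ∑' n, aeval z (R n) * c n := by
  intro z
  have hdiff : DifferentiableOn ℂ (fun z : ℂ => ∑' n, aeval z (R n) * c n)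
      (Metric.ball 0 (‖z‖ + 1)) :=
    Complex.differentiableOn_tsum_of_summable_norm
      (((h.summable_pairNorm_sq (0 : ℂ)).add hc).mul_right _)
      (fun n => ((R n).differentiable_aeval.mul_const _).differentiableOn) Metric.isOpen_ball
      fun n x hx => norm_aeval_mul_le h (hR x) (mem_ball_zero_iff.1 hx).le n
  exact hdiff.differentiableAt (Metric.isOpen_ball.mem_nhds (by simp))

end Growth

/-! ### The functions `A` and `C` -/

section NevanlinnaFunctions

variable {𝕜 : Type} [RCLike 𝕜]

/-- The reproducing kernel `∑ Q_k(z) Q_k(w)` of the polynomials of the second kind. -/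
def kerQ (s : ℕ → ℝ) (z w : 𝕜) : 𝕜 :=
  ∑' k, aeval z (Q s k) * aeval w (Q s k)

theorem nevA_eq (s : ℕ → ℝ) (z : 𝕜) : nevA s z = z * kerQ s z 0 := by
  simp only [nevA, A₂, kerQ, sub_zero]

theorem nevC_eq (s : ℕ → ℝ) (z : 𝕜) :
    nevC s z = 1 + z * ∑' k, aeval z (Q s k) * aeval 0 (P s k) := by
  simp only [nevC, C₂, sub_zero]

theorem summable_norm_sq_aeval_P (h : IsIndeterminate s) (z : 𝕜) :
    Summable fun k => ‖aeval z (P s k)‖ ^ 2 :=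
  summable_norm_sq_of_le_pairNorm h (norm_aeval_P_le_pairNorm s z)

theorem summable_norm_sq_aeval_Q (h : IsIndeterminate s) (z : 𝕜) :
    Summable fun k => ‖aeval z (Q s k)‖ ^ 2 :=
  summable_norm_sq_of_le_pairNorm h (norm_aeval_Q_le_pairNorm s z)

theorem summable_aeval_Q_mul_aeval_P (h : IsIndeterminate s) (z w : 𝕜) :
    Summable fun k => aeval z (Q s k) * aeval w (P s k) :=
  summable_aeval_mul h (norm_aeval_Q_le_pairNorm s z) (summable_norm_sq_aeval_P h w)

theorem summable_kerQ (h : IsIndeterminate s) (z w : 𝕜) :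
    Summable fun k => aeval z (Q s k) * aeval w (Q s k) :=
  summable_aeval_mul h (norm_aeval_Q_le_pairNorm s z) (summable_norm_sq_aeval_Q h w)

theorem continuous_kerQ (h : IsIndeterminate s) (w : 𝕜) : Continuous fun z => kerQ s z w :=
  continuous_tsum_aeval_mul h (norm_aeval_Q_le_pairNorm s) (summable_norm_sq_aeval_Q h w)

theorem continuous_nevA (h : IsIndeterminate s) : Continuous (nevA s : 𝕜 → 𝕜) := by
  rw [_root_.funext (nevA_eq s)]
  exact continuous_id.mul (continuous_kerQ h 0)

theorem continuous_nevC (h : IsIndeterminate s) : Continuous (nevC s : 𝕜 → 𝕜) := by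
  rw [_root_.funext (nevC_eq s)]
  exact continuous_const.add (continuous_id.mul
    (continuous_tsum_aeval_mul h (norm_aeval_Q_le_pairNorm s) (summable_norm_sq_aeval_P h 0)))

theorem differentiable_nevA (h : IsIndeterminate s) : Differentiable ℂ (nevA s : ℂ → ℂ) := by
  rw [_root_.funext (nevA_eq s)]
  exact differentiable_id.mul
    (differentiable_tsum_aeval_mul h (norm_aeval_Q_le_pairNorm s) (summable_norm_sq_aeval_Q h 0))

/-- The `n`-th partial sum of the series defining `nevA`. -/
def partialA (s : ℕ → ℝ) (n : ℕ) (z : 𝕜) : 𝕜 :=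
  z * ∑ k ∈ Finset.range n, aeval z (Q s k) * aeval 0 (Q s k)

/-- The `n`-th partial sum of the series defining `nevC`. -/
def partialC (s : ℕ → ℝ) (n : ℕ) (z : 𝕜) : 𝕜 :=
  1 + z * ∑ k ∈ Finset.range n, aeval z (Q s k) * aeval 0 (P s k)

theorem tendsto_partialA (h : IsIndeterminate s) (z : 𝕜) :
    Tendsto (fun n => partialA s n z) atTop (𝓝 (nevA s z)) := by
  rw [nevA_eq]
  exact (summable_kerQ h z 0).hasSum.tendsto_sum_nat.const_mul z

theorem tendsto_partialC (h : IsIndeterminate s) (z : 𝕜) :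
    Tendsto (fun n => partialC s n z) atTop (𝓝 (nevC s z)) := by
  rw [nevC_eq]
  exact ((summable_aeval_Q_mul_aeval_P h z 0).hasSum.tendsto_sum_nat.const_mul z).const_add 1

theorem aeval_Q_eq_partialC_sub_partialA (hs : IsPosDef s) (n : ℕ) (z : 𝕜) :
    aeval z (Q s n) = aeval 0 (Q s n) * partialC s n z - aeval 0 (P s n) * partialA s n z := by
  have hsum : ∑ k ∈ Finset.range n, volterraKernel s n k 0 * aeval z (Q s k) =
      aeval 0 (Q s n) * ∑ k ∈ Finset.range n, aeval z (Q s k) * aeval 0 (P s k) -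
        aeval 0 (P s n) * ∑ k ∈ Finset.range n, aeval z (Q s k) * aeval (0 : 𝕜) (Q s k) := by
    rw [Finset.mul_sum, Finset.mul_sum, ← Finset.sum_sub_distrib]
    exact Finset.sum_congr rfl fun k _ => by rw [volterraKernel]; ring
  rw [aeval_Q_eq_sum hs n z 0, hsum, partialC, partialA]
  ring

theorem partialA_mul_partialC_sub (hs : IsPosDef s) (n : ℕ) (z w : 𝕜) :
    partialA s n z * partialC s n w - partialC s n z * partialA s n w =
      (z - w) * ∑ k ∈ Finset.range n, aeval z (Q s k) * aeval w (Q s k) := by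
  induction n with
  | zero => simp [partialA, partialC]
  | succ n ih =>
    have hA (u : 𝕜) : partialA s (n + 1) u =
        partialA s n u + u * (aeval u (Q s n) * aeval 0 (Q s n)) := by
      rw [partialA, partialA, Finset.sum_range_succ, mul_add]
    have hC (u : 𝕜) : partialC s (n + 1) u =
        partialC s n u + u * (aeval u (Q s n) * aeval 0 (P s n)) := by
      rw [partialC, partialC, Finset.sum_range_succ, mul_add, add_assoc]
    rw [Finset.sum_range_succ, mul_add, ← ih, hA, hA, hC, hC]
    linear_combination (w * aeval w (Q s n)) * aeval_Q_eq_partialC_sub_partialA hs n z -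
      (z * aeval z (Q s n)) * aeval_Q_eq_partialC_sub_partialA hs n w

theorem nevA_mul_nevC_sub (h : IsIndeterminate s) (z w : 𝕜) :
    nevA s z * nevC s w - nevC s z * nevA s w = (z - w) * kerQ s z w := by
  refine tendsto_nhds_unique (((tendsto_partialA h z).mul (tendsto_partialC h w)).sub
    ((tendsto_partialC h z).mul (tendsto_partialA h w))) ?_
  simp only [partialA_mul_partialC_sub h.isPosDef]
  exact (summable_kerQ h z w).hasSum.tendsto_sum_nat.const_mul (z - w)

theorem aeval_Q_one_ne_zero (hs : IsPosDef s) (z : 𝕜) : aeval z (Q s 1) ≠ 0 := by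
  have hdeg : (Q s 1).degree = 0 := by simpa using degree_Q_succ hs 0
  have hne : (Q s 1).coeff 0 ≠ 0 := coeff_ne_zero_of_eq_degree hdeg
  rw [eq_C_of_degree_eq_zero hdeg, aeval_C]
  simpa using hne

theorem tsum_norm_sq_aeval_Q_pos (h : IsIndeterminate s) (z : 𝕜) :
    0 < ∑' k, ‖aeval z (Q s k)‖ ^ 2 :=
  (summable_norm_sq_aeval_Q h z).tsum_pos (fun _ => sq_nonneg _) 1
    (pow_pos (norm_pos_iff.2 (aeval_Q_one_ne_zero h.isPosDef z)) 2)

theorem kerQ_self_pos (h : IsIndeterminate s) (x : ℝ) : 0 < kerQ s x x := by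
  simpa only [kerQ, Real.norm_eq_abs, sq, abs_mul_abs_self] using tsum_norm_sq_aeval_Q_pos h x

theorem nevA_ofReal (s : ℕ → ℝ) (x : ℝ) : nevA s (x : ℂ) = ((nevA s x : ℝ) : ℂ) := by
  have haeval (p : ℝ[X]) (y : ℝ) : aeval (y : ℂ) p = ((p.eval y : ℝ) : ℂ) := aeval_ofReal p y
  rw [nevA_eq, nevA_eq, kerQ, kerQ, ← Complex.ofReal_zero]
  simp only [haeval, Complex.ofReal_mul, Complex.ofReal_tsum, coe_aeval_eq_eval]

theorem nevA_conj (s : ℕ → ℝ) (z : ℂ) :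
    nevA s (starRingEnd ℂ z) = starRingEnd ℂ (nevA s z) := by
  rw [nevA_eq, nevA_eq, kerQ, kerQ, map_mul, Complex.conj_tsum]
  congr 1
  refine tsum_congr fun k => ?_
  rw [map_mul, Polynomial.aeval_conj, ← Polynomial.aeval_conj _ 0, map_zero]

theorem kerQ_conj (s : ℕ → ℝ) (z : ℂ) :
    kerQ s z (starRingEnd ℂ z) = ((∑' k, ‖aeval z (Q s k)‖ ^ 2 : ℝ) : ℂ) := by
  rw [kerQ, Complex.ofReal_tsum]
  refine tsum_congr fun k => ?_
  rw [Polynomial.aeval_conj, Complex.mul_conj', Complex.ofReal_pow]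

theorem im_eq_zero_of_nevA_eq_zero (h : IsIndeterminate s) {z : ℂ} (hz : nevA s z = 0) :
    z.im = 0 := by
  have hcd := nevA_mul_nevC_sub h z (starRingEnd ℂ z)
  rw [nevA_conj, hz, map_zero, zero_mul, mul_zero, sub_zero, kerQ_conj] at hcd
  have hker : ((∑' k, ‖aeval z (Q s k)‖ ^ 2 : ℝ) : ℂ) ≠ 0 :=
    Complex.ofReal_ne_zero.2 (tsum_norm_sq_aeval_Q_pos h z).ne'
  have hconj : z - starRingEnd ℂ z = 0 := (mul_eq_zero.1 hcd.symm).resolve_right hker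
  exact Complex.conj_eq_iff_im.1 (sub_eq_zero.1 hconj).symm

theorem nevA_eq_zero_iff (h : IsIndeterminate s) (z : ℂ) :
    nevA s z = 0 ↔ ∃ x : ℝ, nevA s x = 0 ∧ z = x := by
  refine ⟨fun hz => ⟨z.re, ?_, ?_⟩, ?_⟩
  · have hre : (z.re : ℂ) = z := Complex.ext rfl (im_eq_zero_of_nevA_eq_zero h hz).symm
    rwa [← hre, nevA_ofReal, Complex.ofReal_eq_zero] at hz
  · exact Complex.ext rfl (im_eq_zero_of_nevA_eq_zero h hz)
  · rintro ⟨x, hx, rfl⟩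
    rw [nevA_ofReal, hx, Complex.ofReal_zero]

end NevanlinnaFunctions

section MonotonicityAndPoles

theorem hasDerivAt_nevC_div_nevA (h : IsIndeterminate s) {x : ℝ} (hx : nevA s x ≠ 0) :
    HasDerivAt (fun x : ℝ => nevC s x / nevA s x) (-kerQ s x x / nevA s x ^ 2) x := by
  rw [hasDerivAt_iff_tendsto_slope]
  have hker : Tendsto (fun y : ℝ => kerQ s y x) (𝓝[≠] x) (𝓝 (kerQ s x x)) :=
    ((continuous_kerQ h x).tendsto x).mono_left nhdsWithin_le_nhds
  have hA : Tendsto (fun y : ℝ => nevA s y) (𝓝[≠] x) (𝓝 (nevA s x)) :=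
    ((continuous_nevA h).tendsto x).mono_left nhdsWithin_le_nhds
  have hlim := hker.neg.div (hA.mul_const (nevA s x)) (mul_ne_zero hx hx)
  rw [← sq] at hlim
  refine hlim.congr' ?_
  filter_upwards [hA.eventually_ne hx, self_mem_nhdsWithin] with y hy hyx
  have hsub : y - x ≠ 0 := sub_ne_zero.2 hyx
  simp only [Pi.div_apply, slope_def_field]
  field_simp
  linear_combination nevA_mul_nevC_sub h y x

theorem strictAntiOn_nevC_div_nevA (h : IsIndeterminate s) {S : Set ℝ} (hS : Convex ℝ S)
    (hA : ∀ x ∈ S, nevA s x ≠ 0) : StrictAntiOn (fun x : ℝ => nevC s x / nevA s x) S := by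
  refine strictAntiOn_of_deriv_neg hS
    (fun x hx => (hasDerivAt_nevC_div_nevA h (hA x hx)).continuousAt.continuousWithinAt)
    fun x hx => ?_
  have hx' := hA x (interior_subset hx)
  rw [(hasDerivAt_nevC_div_nevA h hx').deriv]
  exact div_neg_of_neg_of_pos (neg_neg_of_pos (kerQ_self_pos h x)) (by positivity)

theorem nevC_ne_zero_of_nevA_eq_zero (h : IsIndeterminate s) {a : ℝ} (ha : nevA s a = 0) :
    nevC s a ≠ 0 := by
  intro hC
  have hpos : ∀ᶠ y in 𝓝[≠] a, 0 < kerQ s y a :=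
    ((continuous_kerQ h a).tendsto a).mono_left nhdsWithin_le_nhds
      |>.eventually_const_lt (kerQ_self_pos h a)
  obtain ⟨y, hy, hya⟩ := (hpos.and self_mem_nhdsWithin).exists
  have := nevA_mul_nevC_sub h y a
  rw [ha, hC, mul_zero, mul_zero, sub_zero] at this
  exact mul_ne_zero (sub_ne_zero.2 hya) hy.ne' this.symm

theorem hasDerivAt_nevA (h : IsIndeterminate s) {a : ℝ} (ha : nevA s a = 0) :
    HasDerivAt (fun x : ℝ => nevA s x) (kerQ s a a / nevC s a) a := by
  have hC := nevC_ne_zero_of_nevA_eq_zero h ha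
  rw [hasDerivAt_iff_tendsto_slope]
  refine Tendsto.congr' ?_ ((((continuous_kerQ h a).tendsto a).mono_left
    nhdsWithin_le_nhds).div_const (nevC s a))
  filter_upwards [self_mem_nhdsWithin] with y hy
  have hsub : y - a ≠ 0 := sub_ne_zero.2 hy
  rw [slope_def_field, ha]
  field_simp
  linear_combination -ha * nevC s y - nevA_mul_nevC_sub h y a

theorem tendsto_div_inv_sub {f g : ℝ → ℝ} {f' a : ℝ} (hfa : f a = 0) (hf : HasDerivAt f f' a)
    (hg : ContinuousAt g a) (hf' : f' ≠ 0) :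
    Tendsto (fun x => g x / f x / (x - a)⁻¹) (𝓝[≠] a) (𝓝 (g a / f')) := by
  refine Tendsto.congr (fun x => ?_)
    ((hg.mono_left nhdsWithin_le_nhds).div (hasDerivAt_iff_tendsto_slope.1 hf) hf')
  simp only [Pi.div_apply, slope_def_field, hfa, sub_zero, div_inv_eq_mul]
  rw [div_div_eq_mul_div, div_mul_eq_mul_div]

theorem tendsto_div_nhdsGT_atTop {f g : ℝ → ℝ} {f' a : ℝ} (hfa : f a = 0)
    (hf : HasDerivAt f f' a) (hg : ContinuousAt g a) (hpos : 0 < g a / f') :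
    Tendsto (fun x => g x / f x) (𝓝[>] a) atTop := by
  have hf' : f' ≠ 0 := fun h0 => hpos.ne' (by rw [h0, div_zero])
  have hsub : Tendsto (fun x : ℝ => x - a) (𝓝[>] a) (𝓝[>] 0) :=
    tendsto_nhdsWithin_of_tendsto_nhds_of_eventually_within _
      ((tendsto_sub_nhds_zero_iff.2 tendsto_id).mono_left nhdsWithin_le_nhds)
      (by filter_upwards [self_mem_nhdsWithin] with x hx using sub_pos.2 (Set.mem_Ioi.1 hx))
  refine Tendsto.congr' ?_ (((tendsto_div_inv_sub hfa hf hg hf').mono_left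
    (nhdsWithin_mono a fun x hx => ne_of_gt hx)).pos_mul_atTop hpos
      (tendsto_inv_nhdsGT_zero.comp hsub))
  filter_upwards [self_mem_nhdsWithin] with x hx
  exact div_mul_cancel₀ _ (inv_ne_zero (sub_pos.2 hx).ne')

theorem tendsto_div_nhdsLT_atBot {f g : ℝ → ℝ} {f' a : ℝ} (hfa : f a = 0)
    (hf : HasDerivAt f f' a) (hg : ContinuousAt g a) (hpos : 0 < g a / f') :
    Tendsto (fun x => g x / f x) (𝓝[<] a) atBot := by
  have hf' : f' ≠ 0 := fun h0 => hpos.ne' (by rw [h0, div_zero])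
  have hsub : Tendsto (fun x : ℝ => x - a) (𝓝[<] a) (𝓝[<] 0) :=
    tendsto_nhdsWithin_of_tendsto_nhds_of_eventually_within _
      ((tendsto_sub_nhds_zero_iff.2 tendsto_id).mono_left nhdsWithin_le_nhds)
      (by filter_upwards [self_mem_nhdsWithin] with x hx using sub_neg.2 (Set.mem_Iio.1 hx))
  refine Tendsto.congr' ?_ (((tendsto_div_inv_sub hfa hf hg hf').mono_left
    (nhdsWithin_mono a fun x hx => ne_of_lt hx)).pos_mul_atBot hpos
      (tendsto_inv_nhdsLT_zero.comp hsub))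
  filter_upwards [self_mem_nhdsWithin] with x hx
  exact div_mul_cancel₀ _ (inv_ne_zero (sub_neg.2 hx).ne)

theorem nevC_div_deriv_nevA_pos (h : IsIndeterminate s) {a : ℝ} (ha : nevA s a = 0) :
    0 < nevC s a / (kerQ s a a / nevC s a) := by
  rw [div_div_eq_mul_div]
  exact div_pos (mul_self_pos.2 (nevC_ne_zero_of_nevA_eq_zero h ha)) (kerQ_self_pos h a)

theorem tendsto_nevC_div_nevA_nhdsGT (h : IsIndeterminate s) {a : ℝ} (ha : nevA s a = 0) :
    Tendsto (fun x : ℝ => nevC s x / nevA s x) (𝓝[>] a) atTop :=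
  tendsto_div_nhdsGT_atTop ha (hasDerivAt_nevA h ha) (continuous_nevC h).continuousAt
    (nevC_div_deriv_nevA_pos h ha)

theorem tendsto_nevC_div_nevA_nhdsLT (h : IsIndeterminate s) {a : ℝ} (ha : nevA s a = 0) :
    Tendsto (fun x : ℝ => nevC s x / nevA s x) (𝓝[<] a) atBot :=
  tendsto_div_nhdsLT_atBot ha (hasDerivAt_nevA h ha) (continuous_nevC h).continuousAt
    (nevC_div_deriv_nevA_pos h ha)

end MonotonicityAndPoles

/-! ### Signs on the negative half-line -/

section StieltjesSigns

theorem IsStieltjes.exists_isSolution_ae_nonneg (hS : IsStieltjes s) :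
    ∃ μ, IsSolution s μ ∧ ∀ᵐ y ∂μ, 0 ≤ y := by
  obtain ⟨μ, hμ, hμ0⟩ := hS
  exact ⟨μ, hμ, by simpa only [ae_iff, not_le] using! hμ0⟩

/- At a zero `x ≤ 0` of `P_n = (X - x) q`, orthogonality gives `∫ (y - x) q(y)² dμ(y) = 0` with a
nonnegative integrand, so that `P_n` vanishes almost everywhere. -/
theorem eval_P_ne_zero (hs : IsPosDef s) (hS : IsStieltjes s) (n : ℕ) {x : ℝ} (hx : x ≤ 0) :
    (P s n).eval x ≠ 0 := by
  intro h0
  obtain ⟨μ, hμ, hnn⟩ := hS.exists_isSolution_ae_nonneg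
  set q := P s n /ₘ (X - C x)
  have hP : P s n = (X - C x) * q := by
    simpa only [h0, C_0, add_zero] using (X_sub_C_mul_divByMonic_add (P s n) x).symm
  have heval : ∀ y, (q * P s n).eval y = (y - x) * q.eval y ^ 2 := fun y => by
    rw [hP]
    simp only [eval_mul, eval_sub, eval_X, eval_C]
    ring
  have hint : ∫ y, (q * P s n).eval y ∂μ = 0 := by
    rw [hμ.integral_eval]
    exact momentMap_mul_P_of_degree_lt hs (degree_divByMonic_X_sub_C_lt (degree_P hs n).le x)
  have hnonneg : 0 ≤ᵐ[μ] fun y => (q * P s n).eval y := by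
    filter_upwards [hnn] with y hy
    rw [Pi.zero_apply, heval]
    exact mul_nonneg (by linarith) (sq_nonneg _)
  have hzero := (integral_eq_zero_iff_of_nonneg_ae hnonneg (hμ.integrable_eval _)).1 hint
  have hPP : ∫ y, (P s n * P s n).eval y ∂μ = 0 := by
    refine integral_eq_zero_of_ae ?_
    filter_upwards [hzero] with y hy
    have hfactor : (P s n * P s n).eval y = (y - x) * (q * P s n).eval y := by
      nth_rw 1 [hP]
      simp only [eval_mul, eval_sub, eval_X, eval_C]
      ring
    rw [hfactor, hy, Pi.zero_apply, mul_zero]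
  rw [hμ.integral_eval, momentMap_P_mul_P hs, if_pos rfl] at hPP
  exact one_ne_zero hPP

theorem neg_one_pow_mul_eval_P_pos (hs : IsPosDef s) (hS : IsStieltjes s) (n : ℕ) {x : ℝ}
    (hx : x ≤ 0) : 0 < (-1) ^ n * (P s n).eval x := by
  have hroots : ∀ y, (P s n).IsRoot y → x < y := fun y hy => by
    by_contra! hyx
    exact eval_P_ne_zero hs hS n (hyx.trans hx) hy
  have hlead : 0 ≤ (P s n).leadingCoeff := by
    rw [leadingCoeff_P]
    exact (leadP_pos hs n).le
  simpa only [natDegree_P hs, Int.cast_negOnePow_natCast] using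
    zero_lt_negOnePow_mul_eval_of_lt_roots_of_leadingCoeff_nonneg hroots hlead

theorem mul_pos_of_neg_one_pow_mul_pos {n : ℕ} {a b : ℝ} (ha : 0 < (-1) ^ n * a)
    (hb : 0 < (-1) ^ n * b) : 0 < a * b := by
  have h := mul_pos ha hb
  rwa [mul_mul_mul_comm, ← mul_pow, neg_one_mul, neg_neg, one_pow, one_mul] at h

theorem eval_Q_div_eval_P_strictAnti (hs : IsPosDef s) (hS : IsStieltjes s) {x : ℝ} (hx : x ≤ 0) :
    StrictAnti fun n => (Q s n).eval x / (P s n).eval x := by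
  refine strictAnti_nat_of_succ_lt fun n => ?_
  have hn := eval_P_ne_zero hs hS n hx
  have hn1 := eval_P_ne_zero hs hS (n + 1) hx
  have hneg : (P s n).eval x * (P s (n + 1)).eval x < 0 := by
    have h := neg_one_pow_mul_eval_P_pos hs hS (n + 1) hx
    rw [pow_succ, mul_assoc, neg_one_mul] at h
    linarith [mul_pos_of_neg_one_pow_mul_pos (neg_one_pow_mul_eval_P_pos hs hS n hx) h]
  have hsub : (Q s (n + 1)).eval x / (P s (n + 1)).eval x - (Q s n).eval x / (P s n).eval x =
      volterraKernel s (n + 1) n x / ((P s n).eval x * (P s (n + 1)).eval x) := by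
    simp only [volterraKernel, coe_aeval_eq_eval]
    field_simp
  rw [← sub_neg, hsub]
  exact div_neg_of_pos_of_neg (volterraKernel_succ_pos hs n x) hneg

theorem eval_Q_div_eval_P_neg (hs : IsPosDef s) (hS : IsStieltjes s) (n : ℕ) {x : ℝ}
    (hx : x ≤ 0) : (Q s (n + 1)).eval x / (P s (n + 1)).eval x < 0 := by
  simpa only [Q_zero hs, eval_zero, zero_div] using
    eval_Q_div_eval_P_strictAnti hs hS hx n.succ_pos

theorem neg_one_pow_mul_neg_eval_Q_pos (hs : IsPosDef s) (hS : IsStieltjes s) (n : ℕ) {x : ℝ}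
    (hx : x ≤ 0) : 0 < (-1) ^ (n + 1) * -(Q s (n + 1)).eval x := by
  have h := mul_pos (neg_one_pow_mul_eval_P_pos hs hS (n + 1) hx)
    (neg_pos.2 (eval_Q_div_eval_P_neg hs hS n hx))
  have hP := eval_P_ne_zero hs hS (n + 1) hx
  rwa [mul_assoc, mul_neg, mul_div_cancel₀ _ hP] at h

theorem eval_Q_mul_eval_Q_pos (hs : IsPosDef s) (hS : IsStieltjes s) (n : ℕ) {x y : ℝ}
    (hx : x ≤ 0) (hy : y ≤ 0) : 0 < (Q s (n + 1)).eval x * (Q s (n + 1)).eval y := by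
  simpa only [neg_mul_neg] using mul_pos_of_neg_one_pow_mul_pos
    (neg_one_pow_mul_neg_eval_Q_pos hs hS n hx) (neg_one_pow_mul_neg_eval_Q_pos hs hS n hy)

theorem eval_P_mul_neg_eval_Q_pos (hs : IsPosDef s) (hS : IsStieltjes s) (n : ℕ) {x y : ℝ}
    (hx : x ≤ 0) (hy : y ≤ 0) : 0 < (P s (n + 1)).eval x * -(Q s (n + 1)).eval y :=
  mul_pos_of_neg_one_pow_mul_pos (neg_one_pow_mul_eval_P_pos hs hS (n + 1) hx)
    (neg_one_pow_mul_neg_eval_Q_pos hs hS n hy)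

theorem exists_tendsto_eval_P_div_eval_Q (hs : IsPosDef s) (hS : IsStieltjes s) :
    ∃ a : ℝ, Tendsto (fun n => (P s n).eval 0 / (Q s n).eval 0) atTop (𝓝 a) := by
  have hneg : ∀ n, (Q s (n + 1)).eval 0 / (P s (n + 1)).eval 0 < 0 := fun n =>
    eval_Q_div_eval_P_neg hs hS n le_rfl
  have hmono : Monotone fun n => (P s (n + 1)).eval 0 / (Q s (n + 1)).eval 0 :=
    monotone_nat_of_le_succ fun n => by
      simpa only [inv_div] using (inv_le_inv_of_neg (hneg n) (hneg (n + 1))).2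
        (eval_Q_div_eval_P_strictAnti hs hS le_rfl (n + 1).lt_succ_self).le
  have hbdd : BddAbove (Set.range fun n => (P s (n + 1)).eval 0 / (Q s (n + 1)).eval 0) := by
    refine ⟨0, Set.forall_mem_range.2 fun n => ?_⟩
    simpa only [inv_div] using (inv_neg''.2 (hneg n)).le
  exact ⟨_, (tendsto_add_atTop_iff_nat 1).1 (tendsto_atTop_ciSup hmono hbdd)⟩

end StieltjesSigns

/-! ### Behaviour at `-∞` -/

section WeightedMeans

variable {ι : Type*} {l : Filter ι} {W : ℕ → ι → ℝ} {ρ : ℕ → ℝ}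

theorem summable_mul_of_tendsto {a : ℝ} (hρ : Tendsto ρ atTop (𝓝 a)) {w : ℕ → ℝ}
    (hw : Summable w) : Summable fun k => ρ k * w k :=
  summable_of_isBigO_nat hw <| by
    simpa only [one_mul] using (hρ.isBigO_one ℝ).mul (Asymptotics.isBigO_refl w atTop)

theorem tendsto_tsum_mul_weight_zero (hρ : Tendsto ρ atTop (𝓝 0))
    (hW0 : ∀ᶠ x in l, ∀ k, 0 ≤ W k x) (hW1 : ∀ᶠ x in l, HasSum (fun k => W k x) 1)
    (hW : ∀ k, Tendsto (W k) l (𝓝 0)) :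
    Tendsto (fun x => ∑' k, ρ k * W k x) l (𝓝 0) := by
  rw [Metric.tendsto_nhds]
  intro ε hε
  obtain ⟨N, hN⟩ := Metric.tendsto_atTop.1 hρ (ε / 2) (half_pos hε)
  have hhead : Tendsto (fun x => ∑ k ∈ Finset.range N, ρ k * W k x) l (𝓝 0) := by
    simpa only [mul_zero, Finset.sum_const_zero] using
      tendsto_finsetSum (Finset.range N) fun k _ => (hW k).const_mul (ρ k)
  filter_upwards [hW0, hW1, Metric.tendsto_nhds.1 hhead (ε / 2) (half_pos hε)] with x h0 h1 hx
  have hshift := (summable_nat_add_iff N).2 h1.summable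
  have hshift_le : ∑' k, W (k + N) x ≤ 1 := by
    linarith [h1.summable.sum_add_tsum_nat_add N, h1.tsum_eq,
      Finset.sum_nonneg fun k (_ : k ∈ Finset.range N) => h0 k]
  have htail : ‖∑' k, ρ (k + N) * W (k + N) x‖ ≤ ε / 2 := by
    calc ‖∑' k, ρ (k + N) * W (k + N) x‖ ≤ ∑' k, ε / 2 * W (k + N) x := by
          refine tsum_of_norm_bounded (hshift.mul_left _).hasSum fun k => ?_
          rw [norm_mul, Real.norm_of_nonneg (h0 _)]
          have hk := hN (k + N) (by omega)
          rw [dist_zero_right] at hk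
          exact mul_le_mul_of_nonneg_right hk.le (h0 _)
      _ = ε / 2 * ∑' k, W (k + N) x := tsum_mul_left
      _ ≤ ε / 2 := mul_le_of_le_one_right (half_pos hε).le hshift_le
  rw [dist_zero_right] at hx ⊢
  rw [← (summable_mul_of_tendsto hρ h1.summable).sum_add_tsum_nat_add N]
  exact (norm_add_le _ _).trans_lt (by linarith)

theorem tendsto_tsum_mul_weight {a : ℝ} (hρ : Tendsto ρ atTop (𝓝 a))
    (hW0 : ∀ᶠ x in l, ∀ k, 0 ≤ W k x) (hW1 : ∀ᶠ x in l, HasSum (fun k => W k x) 1)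
    (hW : ∀ k, Tendsto (W k) l (𝓝 0)) :
    Tendsto (fun x => ∑' k, ρ k * W k x) l (𝓝 a) := by
  have hdiff := tendsto_tsum_mul_weight_zero (tendsto_sub_nhds_zero_iff.2 hρ) hW0 hW1 hW
  refine tendsto_sub_nhds_zero_iff.1 (hdiff.congr' ?_)
  filter_upwards [hW1] with x h1
  simp only [sub_mul]
  rw [(summable_mul_of_tendsto hρ h1.summable).tsum_sub (h1.summable.mul_left a), tsum_mul_left,
    h1.tsum_eq, mul_one]

end WeightedMeans

section PositiveSeries

variable {R : ℕ → ℝ[X]} {b c : ℕ → ℝ} {S : ℝ → ℝ}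

theorem tendsto_eval_div_hasSum_atBot
    (hpos : ∀ᶠ x in atBot, ∀ k, 0 < (R k).eval x * c k)
    (hS : ∀ᶠ x in atBot, HasSum (fun k => (R k).eval x * c k) (S x)) {p : ℝ[X]} {k : ℕ}
    (hp : p.degree < (R k).degree) : Tendsto (fun x => p.eval x / S x) atBot (𝓝 0) := by
  have hlim : Tendsto (fun x => |p.eval x / (R k).eval x| * |c k|⁻¹) atBot (𝓝 0) := by
    simpa only [abs_zero, zero_mul] using
      (div_tendsto_atBot_zero_of_degree_lt p (R k) hp).abs.mul_const |c k|⁻¹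
  refine squeeze_zero_norm' ?_ hlim
  filter_upwards [hpos, hS] with x hx hSx
  have hle : (R k).eval x * c k ≤ S x := le_hasSum hSx k fun j _ => (hx j).le
  calc ‖p.eval x / S x‖ = |p.eval x| / S x := by
        rw [norm_div, Real.norm_eq_abs, Real.norm_of_nonneg ((hx k).le.trans hle)]
    _ ≤ |p.eval x| / |(R k).eval x * c k| := by
        rw [abs_of_pos (hx k)]
        exact div_le_div_of_nonneg_left (abs_nonneg _) (hx k) hle
    _ = |p.eval x / (R k).eval x| * |c k|⁻¹ := by
        rw [abs_mul, abs_div]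
        ring

theorem tendsto_inv_hasSum_atBot (hdeg : ∀ k, (R k).degree < (R (k + 1)).degree)
    (hpos : ∀ᶠ x in atBot, ∀ k, 0 < (R k).eval x * c k)
    (hS : ∀ᶠ x in atBot, HasSum (fun k => (R k).eval x * c k) (S x)) :
    Tendsto (fun x => (S x)⁻¹) atBot (𝓝 0) := by
  obtain ⟨x, hx⟩ := hpos.exists
  have hR : R 0 ≠ 0 := fun h => by simpa only [h, eval_zero, zero_mul, lt_irrefl] using hx 0
  have hone : (1 : ℝ[X]).degree < (R 1).degree :=
    degree_one_le.trans_lt ((zero_le_degree_iff.2 hR).trans_lt (hdeg 0))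
  simpa only [eval_one, one_div] using tendsto_eval_div_hasSum_atBot hpos hS hone

theorem tendsto_tsum_div_hasSum_atBot (hdeg : ∀ k, (R k).degree < (R (k + 1)).degree)
    (hpos : ∀ᶠ x in atBot, ∀ k, 0 < (R k).eval x * c k)
    (hS : ∀ᶠ x in atBot, HasSum (fun k => (R k).eval x * c k) (S x)) {a : ℝ}
    (ha : Tendsto (fun k => b k / c k) atTop (𝓝 a)) :
    Tendsto (fun x => (∑' k, (R k).eval x * b k) / S x) atBot (𝓝 a) := by
  have hSpos : ∀ᶠ x in atBot, 0 < S x := by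
    filter_upwards [hpos, hS] with x hx hSx
    exact (hx 0).trans_le (le_hasSum hSx 0 fun j _ => (hx j).le)
  refine (tendsto_tsum_mul_weight (W := fun k x => (R k).eval x * c k / S x) ha ?_ ?_
    fun k => ?_).congr' ?_
  · filter_upwards [hpos, hSpos] with x hx hSx k
    exact div_nonneg (hx k).le hSx.le
  · filter_upwards [hS, hSpos] with x hx hSx
    simpa only [div_self hSx.ne'] using hx.div_const (S x)
  · simpa only [zero_mul, div_mul_eq_mul_div] using
      (tendsto_eval_div_hasSum_atBot hpos hS (hdeg k)).mul_const (c k)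
  · filter_upwards [hpos] with x hx
    rw [← tsum_div_const]
    refine tsum_congr fun k => ?_
    have hc : c k ≠ 0 := right_ne_zero_of_mul (hx k).ne'
    field_simp

end PositiveSeries

section BehaviourAtBot

theorem hasSum_kerQ_zero (h : IsIndeterminate s) (x : ℝ) :
    HasSum (fun k => (Q s (k + 1)).eval x * (Q s (k + 1)).eval 0) (kerQ s x 0) := by
  have hsum := (hasSum_nat_add_iff' 1).2 (summable_kerQ h x 0).hasSum
  simpa only [kerQ, Finset.sum_range_one, Q_zero h.isPosDef, coe_aeval_eq_eval, eval_zero,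
    mul_zero, sub_zero] using hsum

theorem eventually_eval_Q_mul_eval_Q_pos (hs : IsPosDef s) (hS : IsStieltjes s) :
    ∀ᶠ x in atBot, ∀ k, 0 < (Q s (k + 1)).eval x * (Q s (k + 1)).eval 0 := by
  filter_upwards [eventually_le_atBot (0 : ℝ)] with x hx k
  exact eval_Q_mul_eval_Q_pos hs hS k hx le_rfl

theorem eventually_eval_P_mul_neg_eval_Q_pos (hs : IsPosDef s) (hS : IsStieltjes s) :
    ∀ᶠ x in atBot, ∀ k, 0 < (P s (k + 1)).eval x * -(Q s (k + 1)).eval 0 := by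
  filter_upwards [eventually_le_atBot (0 : ℝ)] with x hx k
  exact eval_P_mul_neg_eval_Q_pos hs hS k hx le_rfl

theorem kerQ_zero_pos (h : IsIndeterminate s) (hS : IsStieltjes s) {x : ℝ} (hx : x ≤ 0) :
    0 < kerQ s x 0 :=
  have hpos := fun k => eval_Q_mul_eval_Q_pos h.isPosDef hS k hx le_rfl
  (hpos 0).trans_le (le_hasSum (hasSum_kerQ_zero h x) 0 fun k _ => (hpos k).le)

theorem nevA_neg (h : IsIndeterminate s) (hS : IsStieltjes s) {x : ℝ} (hx : x < 0) :
    nevA s x < 0 := by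
  rw [nevA_eq]
  exact mul_neg_of_neg_of_pos hx (kerQ_zero_pos h hS hx.le)

theorem tendsto_eval_div_nevA_atBot (h : IsIndeterminate s) (hS : IsStieltjes s) (p : ℝ[X]) :
    Tendsto (fun x => p.eval x / nevA s x) atBot (𝓝 0) := by
  have hdeg : p.degree < (Q s (p.natDegree + 1 + 1)).degree := by
    rw [degree_Q_succ h.isPosDef]
    exact degree_le_natDegree.trans_lt (by exact_mod_cast p.natDegree.lt_succ_self)
  have hlim := (tendsto_eval_div_hasSum_atBot (c := fun k => (Q s (k + 1)).eval 0)
    (eventually_eval_Q_mul_eval_Q_pos h.isPosDef hS) (Eventually.of_forall (hasSum_kerQ_zero h))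
    (k := p.natDegree + 1) hdeg).mul tendsto_inv_atBot_zero
  rw [zero_mul] at hlim
  refine hlim.congr fun x => ?_
  rw [nevA_eq, div_mul_eq_div_div_swap, div_eq_mul_inv _ x]

theorem tendsto_nevC_div_nevA_atBot (h : IsIndeterminate s) (hS : IsStieltjes s) {a : ℝ}
    (ha : Tendsto (fun n => (P s n).eval 0 / (Q s n).eval 0) atTop (𝓝 a)) :
    Tendsto (fun x : ℝ => nevC s x / nevA s x) atBot (𝓝 a) := by
  have hC : ∀ x : ℝ, nevC s x = 1 + x * ∑' k, (Q s (k + 1)).eval x * (P s (k + 1)).eval 0 := by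
    intro x
    rw [nevC_eq, (summable_aeval_Q_mul_aeval_P h x 0).tsum_eq_zero_add]
    simp only [Q_zero h.isPosDef, map_zero, zero_mul, zero_add, coe_aeval_eq_eval]
  have hmean := tendsto_tsum_div_hasSum_atBot (fun k => degree_Q_lt_succ h.isPosDef (k + 1))
    (eventually_eval_Q_mul_eval_Q_pos h.isPosDef hS) (Eventually.of_forall (hasSum_kerQ_zero h))
    ((tendsto_add_atTop_iff_nat 1).2 ha)
  have hone : Tendsto (fun x : ℝ => 1 / nevA s x) atBot (𝓝 0) := by
    simpa only [eval_one] using tendsto_eval_div_nevA_atBot h hS 1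
  have hlim := hone.add hmean
  rw [zero_add] at hlim
  refine hlim.congr' ?_
  filter_upwards [eventually_lt_atBot (0 : ℝ)] with x hx
  rw [hC, add_div, nevA_eq, mul_div_mul_left _ _ hx.ne]

theorem summable_aeval_P_mul_aeval_P (h : IsIndeterminate s) (x y : ℝ) :
    Summable fun k => aeval x (P s k) * aeval y (P s k) :=
  summable_aeval_mul h (norm_aeval_P_le_pairNorm s x) (summable_norm_sq_aeval_P h y)

theorem summable_aeval_P_mul_aeval_Q (h : IsIndeterminate s) (x y : ℝ) :
    Summable fun k => aeval x (P s k) * aeval y (Q s k) :=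
  summable_aeval_mul h (norm_aeval_P_le_pairNorm s x) (summable_norm_sq_aeval_Q h y)

theorem nevB_eq (h : IsIndeterminate s) (x : ℝ) :
    nevB s x = -(1 + x * ∑' k, (P s (k + 1)).eval x * -(Q s (k + 1)).eval 0) := by
  simp only [nevB, B₂, sub_zero]
  rw [(summable_aeval_P_mul_aeval_Q h x 0).tsum_eq_zero_add]
  simp only [Q_zero h.isPosDef, map_zero, mul_zero, zero_add, coe_aeval_eq_eval, mul_neg, tsum_neg]
  ring

theorem nevD_eq (h : IsIndeterminate s) (x : ℝ) :
    nevD s x = x * (leadP s 0 ^ 2 + ∑' k, (P s (k + 1)).eval x * (P s (k + 1)).eval 0) := by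
  simp only [nevD, D₂, sub_zero]
  rw [(summable_aeval_P_mul_aeval_P h x 0).tsum_eq_zero_add]
  simp only [P_zero h.isPosDef, coe_aeval_eq_eval, eval_C, sq]

theorem tendsto_nevD_div_nevB_atBot (h : IsIndeterminate s) (hS : IsStieltjes s) {a : ℝ}
    (ha : Tendsto (fun n => (P s n).eval 0 / (Q s n).eval 0) atTop (𝓝 a)) :
    Tendsto (fun x : ℝ => nevD s x / nevB s x) atBot (𝓝 a) := by
  set S : ℝ → ℝ := fun x => ∑' k, (P s (k + 1)).eval x * -(Q s (k + 1)).eval 0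
  have hdeg := fun k => degree_P_lt_succ h.isPosDef (k + 1)
  have hpos := eventually_eval_P_mul_neg_eval_Q_pos h.isPosDef hS
  have hsum : ∀ x, HasSum (fun k => (P s (k + 1)).eval x * -(Q s (k + 1)).eval 0) (S x) :=
    fun x => by
      refine Summable.hasSum ?_
      simpa only [mul_neg, coe_aeval_eq_eval] using
        ((summable_nat_add_iff 1).2 (summable_aeval_P_mul_aeval_Q h x 0)).neg
  have hratio : Tendsto (fun k => (P s (k + 1)).eval 0 / -(Q s (k + 1)).eval 0) atTop (𝓝 (-a)) := by
    simpa only [div_neg] using ((tendsto_add_atTop_iff_nat 1).2 ha).neg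
  have hmean := tendsto_tsum_div_hasSum_atBot hdeg hpos (Eventually.of_forall hsum) hratio
  have hinv := tendsto_inv_hasSum_atBot hdeg hpos (Eventually.of_forall hsum)
  have hlim := (((hinv.const_mul (leadP s 0 ^ 2)).add hmean).div
    ((tendsto_inv_atBot_zero.mul hinv).add_const 1) (by norm_num)).neg
  rw [mul_zero, mul_zero, zero_add, zero_add, div_one, neg_neg] at hlim
  refine hlim.congr' ?_
  filter_upwards [eventually_lt_atBot (0 : ℝ), hpos] with x hx hposx
  have hSx : S x ≠ 0 :=
    ((hposx 0).trans_le (le_hasSum (hsum x) 0 fun k _ => (hposx k).le)).ne'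
  have hx0 : x ≠ 0 := hx.ne
  have hB : nevB s x = -(1 + x * S x) := nevB_eq h x
  rw [Pi.div_apply, hB, nevD_eq h, div_neg]
  field_simp

end BehaviourAtBot

/-! ### Entire functions of minimal exponential type -/

section MinimalType

/-- Growth of at most minimal exponential type: order at most `1`, and type `0` if the order
is `1`. -/
def IsMinimalType (f : ℂ → ℂ) : Prop :=
  ∀ ε > 0, ∃ K : ℝ, ∀ z, ‖f z‖ ≤ K * Real.exp (ε * ‖z‖)

theorem isMinimalType_id : IsMinimalType fun z => z := by
  intro ε hε
  refine ⟨ε⁻¹, fun z => ?_⟩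
  rw [le_inv_mul_iff₀ hε]
  linarith [Real.add_one_le_exp (ε * ‖z‖)]

theorem IsMinimalType.mul {f g : ℂ → ℂ} (hf : IsMinimalType f) (hg : IsMinimalType g) :
    IsMinimalType fun z => f z * g z := by
  intro ε hε
  obtain ⟨K, hK⟩ := hf (ε / 2) (half_pos hε)
  obtain ⟨L, hL⟩ := hg (ε / 2) (half_pos hε)
  refine ⟨K * L, fun z => ?_⟩
  calc ‖f z * g z‖ ≤ K * Real.exp (ε / 2 * ‖z‖) * (L * Real.exp (ε / 2 * ‖z‖)) := by
        rw [norm_mul]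
        exact mul_le_mul (hK z) (hL z) (norm_nonneg _) ((norm_nonneg _).trans (hK z))
    _ = K * L * Real.exp (ε * ‖z‖) := by
        rw [mul_mul_mul_comm, ← Real.exp_add, ← add_mul, add_halves]

theorem exists_eq_exp_of_ne_zero {f : ℂ → ℂ} (hf : Differentiable ℂ f) (hf0 : ∀ z, f z ≠ 0) :
    ∃ g : ℂ → ℂ, Differentiable ℂ g ∧ ∀ z, f z = Complex.exp (g z) := by
  have hlogDeriv : Differentiable ℂ fun z => deriv f z / f z :=
    (hf.contDiff (n := 2)).differentiable_deriv_two.div hf hf0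
  obtain ⟨g, hg0, hg⟩ := hlogDeriv.isExactOn_univ.with_val_at 0 (Complex.log (f 0))
  have hquot : ∀ z, HasDerivAt (fun z => f z * Complex.exp (-g z)) 0 z := fun z => by
    refine ((hf z).hasDerivAt.mul (hg z trivial).neg.cexp).congr_deriv ?_
    field_simp [hf0 z]
    ring
  refine ⟨g, fun z => (hg z trivial).differentiableAt, fun z => ?_⟩
  have hconst := is_const_of_deriv_eq_zero (fun z => (hquot z).differentiableAt)
    (fun z => (hquot z).deriv) z 0
  simp only [hg0, Complex.exp_neg, Complex.exp_log (hf0 0), mul_inv_cancel₀ (hf0 0)] at hconst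
  exact (mul_inv_eq_one₀ (Complex.exp_ne_zero _)).1 hconst

theorem eq_of_forall_re_le_add_mul_norm {g : ℂ → ℂ} (hg : Differentiable ℂ g)
    (hre : ∀ ε > 0, ∃ M : ℝ, ∀ z, (g z).re ≤ M + ε * ‖z‖) (z : ℂ) : g z = g 0 := by
  have hsmall : ∀ ε > 0, ‖g z - g 0‖ ≤ ε * (2 * ‖z‖) := by
    intro ε hε
    obtain ⟨M, hM⟩ := hre ε hε
    set M' := max 0 (M - (g 0).re)
    have hbound : ∀ᶠ R in atTop,
        ‖g z - g 0‖ ≤ 2 * (M' + ε * ‖z‖) * ‖z‖ / (R - ‖z‖) + ε * (2 * ‖z‖) := by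
      filter_upwards [eventually_gt_atTop ‖z‖] with R hR
      have hR0 : 0 < R := (norm_nonneg z).trans_lt hR
      have hmaps : Set.MapsTo (fun w => g w - g 0) (Metric.ball 0 R)
          {w | w.re ≤ M' + ε * R} := fun w hw => by
        have hw' : ε * ‖w‖ ≤ ε * R := by gcongr; exact (mem_ball_zero_iff.1 hw).le
        rw [Set.mem_ofPred_eq, Complex.sub_re]
        linarith [hM w, le_max_right 0 (M - (g 0).re)]
      have hcar := Complex.borelCaratheodory_zero
        (add_pos_of_nonneg_of_pos (le_max_left _ _) (mul_pos hε hR0))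
        (hg.sub_const (g 0)).differentiableOn hmaps hR0 (mem_ball_zero_iff.2 hR) (sub_self _)
      refine hcar.trans_eq ?_
      have := (sub_pos.2 hR).ne'
      field_simp
      ring
    have hlim : Tendsto (fun R => 2 * (M' + ε * ‖z‖) * ‖z‖ / (R - ‖z‖) + ε * (2 * ‖z‖)) atTop
        (𝓝 (ε * (2 * ‖z‖))) := by
      have hden := tendsto_atTop_add_const_right atTop (-‖z‖) tendsto_id
      simpa [sub_eq_add_neg] using
        (hden.const_div_atTop (2 * (M' + ε * ‖z‖) * ‖z‖)).add_const (ε * (2 * ‖z‖))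
    exact ge_of_tendsto hlim hbound
  have hlim : Tendsto (fun ε : ℝ => ε * (2 * ‖z‖)) (𝓝[>] 0) (𝓝 0) := by
    simpa using (tendsto_id.mul_const (2 * ‖z‖)).mono_left (nhdsWithin_le_nhds (a := (0 : ℝ)))
  have hzero := ge_of_tendsto hlim (eventually_mem_nhdsWithin.mono hsmall)
  exact sub_eq_zero.1 (norm_le_zero_iff.1 hzero)

theorem IsMinimalType.eq_of_ne_zero {f : ℂ → ℂ} (hf : Differentiable ℂ f)
    (ht : IsMinimalType f) (hf0 : ∀ z, f z ≠ 0) (z : ℂ) : f z = f 0 := by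
  obtain ⟨g, hg, hfg⟩ := exists_eq_exp_of_ne_zero hf hf0
  rw [hfg, hfg 0, eq_of_forall_re_le_add_mul_norm hg (fun ε hε => ?_) z]
  obtain ⟨K, hK⟩ := ht ε hε
  have hK0 : 0 < K := by simpa using (norm_pos_iff.2 (hf0 0)).trans_le (hK 0)
  refine ⟨Real.log K, fun w => ?_⟩
  rw [← Real.exp_le_exp, Real.exp_add, Real.exp_log hK0, ← Complex.norm_exp, ← hfg]
  exact hK w

theorem IsMinimalType.of_sub_mul {g : ℂ → ℂ} {a : ℂ} (hg : Continuous g)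
    (ht : IsMinimalType fun z => (z - a) * g z) : IsMinimalType g := by
  intro ε hε
  obtain ⟨K, hK⟩ := ht ε hε
  obtain ⟨M, hM⟩ := (isCompact_closedBall a 1).exists_bound_of_continuousOn hg.continuousOn
  refine ⟨max K M, fun z => ?_⟩
  rcases le_or_gt (dist z a) 1 with hz | hz
  · calc ‖g z‖ ≤ max K M := (hM z hz).trans (le_max_right _ _)
      _ ≤ max K M * Real.exp (ε * ‖z‖) :=
        le_mul_of_one_le_right
          ((norm_nonneg _).trans ((hM z hz).trans (le_max_right _ _)))
          (Real.one_le_exp (by positivity))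
  · rw [dist_eq_norm] at hz
    calc ‖g z‖ ≤ ‖(z - a) * g z‖ := by
          rw [norm_mul]
          exact le_mul_of_one_le_left (norm_nonneg _) hz.le
      _ ≤ K * Real.exp (ε * ‖z‖) := hK z
      _ ≤ max K M * Real.exp (ε * ‖z‖) := by gcongr; exact le_max_left _ _

theorem IsMinimalType.of_sub_pow_mul {g : ℂ → ℂ} {a : ℂ} (hg : Continuous g) :
    ∀ n : ℕ, IsMinimalType (fun z => (z - a) ^ n * g z) → IsMinimalType g
  | 0, ht => by simpa only [pow_zero, one_mul] using ht
  | n + 1, ht => IsMinimalType.of_sub_pow_mul hg n <|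
      IsMinimalType.of_sub_mul (by fun_prop) <| by simpa only [pow_succ', mul_assoc] using ht

theorem exists_eq_sub_pow_mul {f : ℂ → ℂ} (hf : Differentiable ℂ f) (hf0 : f ≠ 0) (a : ℂ) :
    ∃ (n : ℕ) (g : ℂ → ℂ), Differentiable ℂ g ∧ g a ≠ 0 ∧ ∀ z, f z = (z - a) ^ n * g z := by
  have hfinite : analyticOrderAt f a ≠ ⊤ := fun htop =>
    hf0 <| AnalyticOnNhd.eq_of_eventuallyEq (fun z _ => hf.analyticAt z)
      (fun _ _ => analyticAt_const) (analyticOrderAt_eq_top.1 htop)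
  obtain ⟨n, hn⟩ := ENat.ne_top_iff_exists.1 hfinite
  clear hf0 hfinite
  induction n generalizing f with
  | zero =>
    have hfa : f a ≠ 0 := (hf.analyticAt a).analyticOrderAt_eq_zero.1 hn.symm
    exact ⟨0, f, hf, hfa, fun z => by rw [pow_zero, one_mul]⟩
  | succ n ih =>
    have hfa : f a = 0 := by
      by_contra hfa
      rw [(hf.analyticAt a).analyticOrderAt_eq_zero.2 hfa] at hn
      exact absurd hn (by simp)
    have hd : Differentiable ℂ (dslope f a) := differentiableOn_univ.1 <|
      (Complex.differentiableOn_dslope Filter.univ_mem).2 hf.differentiableOn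
    have hfactor : f = (fun z => z - a) * dslope f a := _root_.funext fun z => by
      rw [Pi.mul_apply, ← smul_eq_mul, sub_smul_dslope, hfa, sub_zero]
    have horder : (n : ℕ∞) = analyticOrderAt (dslope f a) a := by
      rw [hfactor, analyticOrderAt_mul (by fun_prop) (hd.analyticAt a),
        analyticOrderAt_id_sub_const_self, Nat.cast_succ, add_comm] at hn
      exact ENat.add_right_injective_of_ne_top ENat.one_ne_top hn
    obtain ⟨m, g, hg, hga, hgf⟩ := ih hd horder
    refine ⟨m + 1, g, hg, hga, fun z => ?_⟩
    rw [pow_succ', mul_assoc, ← hgf, ← smul_eq_mul, sub_smul_dslope, hfa, sub_zero]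

theorem IsMinimalType.exists_eq_eval {f : ℂ → ℂ} (hf : Differentiable ℂ f)
    (ht : IsMinimalType f) (hfin : {z | f z = 0}.Finite) : ∃ p : ℂ[X], ∀ z, f z = p.eval z := by
  obtain ⟨F, hF⟩ : ∃ F : Finset ℂ, ∀ z, f z = 0 → z ∈ F := ⟨hfin.toFinset, by simp⟩
  clear hfin
  induction F using Finset.induction_on generalizing f with
  | empty =>
    have hf0 : ∀ z, f z ≠ 0 := fun z hz => by simpa using hF z hz
    exact ⟨C (f 0), fun z => by rw [eval_C, ht.eq_of_ne_zero hf hf0]⟩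
  | insert a F _ ih =>
    have hf0 : f ≠ 0 := fun hzero =>
      (insert a F).finite_toSet.infinite_compl.nonempty.elim fun z hz =>
        hz (hF z (congrFun hzero z))
    obtain ⟨n, g, hg, hga, hfg⟩ := exists_eq_sub_pow_mul hf hf0 a
    have hgF : ∀ z, g z = 0 → z ∈ F := fun z hz =>
      (Finset.mem_insert.1 (hF z (by rw [hfg, hz, mul_zero]))).resolve_left fun hza =>
        hga (hza ▸ hz)
    obtain ⟨p, hp⟩ := ih hg
      (IsMinimalType.of_sub_pow_mul hg.continuous n (_root_.funext hfg ▸ ht)) hgF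
    exact ⟨(X - C a) ^ n * p, fun z => by
      rw [hfg, hp, eval_mul, eval_pow, eval_sub, eval_X, eval_C]⟩

theorem exists_norm_eval_le_eval_norm (p : ℂ[X]) : ∃ q : ℝ[X], ∀ z, ‖p.eval z‖ ≤ q.eval ‖z‖ := by
  refine ⟨∑ i ∈ Finset.range (p.natDegree + 1), C ‖p.coeff i‖ * X ^ i, fun z => ?_⟩
  simp only [eval_finsetSum, eval_mul, eval_C, eval_pow, eval_X]
  rw [eval_eq_sum_range]
  exact (norm_sum_le _ _).trans_eq (Finset.sum_congr rfl fun i _ => by rw [norm_mul, norm_pow])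

end MinimalType

/-! ### The zeros of `A` -/

section ProductGrowth

theorem one_add_mul_le_mul_exp {c δ r : ℝ} (hc : 0 ≤ c) (hδ : 0 < δ) (hr : 0 ≤ r) :
    1 + r * c ≤ (1 + c / δ) * Real.exp (δ * r) := by
  calc 1 + r * c ≤ (1 + c / δ) * (δ * r + 1) := by
        have hexpand : (1 + c / δ) * (δ * r + 1) = 1 + r * c + (c / δ + δ * r) := by
          field_simp
          ring
        rw [hexpand]
        exact le_add_of_nonneg_right (by positivity)
    _ ≤ (1 + c / δ) * Real.exp (δ * r) := by gcongr; exact Real.add_one_le_exp _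

theorem exists_finsetProd_one_add_mul_le_mul_exp {ι : Type*} {c : ι → ℝ} (hc : ∀ k, 0 ≤ c k)
    (t : Finset ι) {ε : ℝ} (hε : 0 < ε) :
    ∃ K, 0 ≤ K ∧ ∀ r, 0 ≤ r → ∏ k ∈ t, (1 + r * c k) ≤ K * Real.exp (ε * r) := by
  classical
  induction t using Finset.induction_on generalizing ε with
  | empty =>
    refine ⟨1, zero_le_one, fun r hr => ?_⟩
    rw [Finset.prod_empty, one_mul]
    exact Real.one_le_exp (by positivity)
  | insert a t ha ih =>
    obtain ⟨K, hK0, hK⟩ := ih (half_pos hε)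
    have hca := hc a
    refine ⟨(1 + c a / (ε / 2)) * K, by positivity, fun r hr => ?_⟩
    rw [Finset.prod_insert ha]
    calc (1 + r * c a) * ∏ k ∈ t, (1 + r * c k)
        ≤ (1 + c a / (ε / 2)) * Real.exp (ε / 2 * r) * (K * Real.exp (ε / 2 * r)) :=
          mul_le_mul (one_add_mul_le_mul_exp hca (half_pos hε) hr) (hK r hr)
            (Finset.prod_nonneg fun k _ => add_nonneg zero_le_one (mul_nonneg hr (hc k)))
            (by positivity)
      _ = (1 + c a / (ε / 2)) * K * Real.exp (ε * r) := by
          rw [mul_mul_mul_comm, ← Real.exp_add, ← add_mul, add_halves]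

theorem exists_prod_range_one_add_mul_le_mul_exp {c : ℕ → ℝ} (hc : ∀ k, 0 ≤ c k)
    (hsum : Summable c) {ε : ℝ} (hε : 0 < ε) :
    ∃ K, ∀ r, 0 ≤ r → ∀ n, ∏ k ∈ Finset.range n, (1 + r * c k) ≤ K * Real.exp (ε * r) := by
  obtain ⟨N, hN⟩ : ∃ N, ∑' k, c (k + N) < ε / 2 :=
    ((tendsto_sum_nat_add c).eventually_lt_const (half_pos hε)).exists
  obtain ⟨K, hK0, hK⟩ :=
    exists_finsetProd_one_add_mul_le_mul_exp hc (Finset.range N) (half_pos hε)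
  refine ⟨K, fun r hr n => ?_⟩
  have hone : ∀ k, 1 ≤ 1 + r * c k := fun k => le_add_of_nonneg_right (mul_nonneg hr (hc k))
  have htail : ∏ k ∈ Finset.range n, (1 + r * c (N + k)) ≤ Real.exp (ε / 2 * r) := by
    simp only [add_comm N]
    refine (prod_one_add_mul_le_exp hr (fun k => hc (k + N))
      ((summable_nat_add_iff N).2 hsum) _).trans ?_
    rw [mul_comm r]
    gcongr
  calc ∏ k ∈ Finset.range n, (1 + r * c k)
      ≤ ∏ k ∈ Finset.range (N + n), (1 + r * c k) :=
        Finset.prod_mono_set_of_one_le hone (Finset.range_mono (Nat.le_add_left n N))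
    _ = (∏ k ∈ Finset.range N, (1 + r * c k)) * ∏ k ∈ Finset.range n, (1 + r * c (N + k)) :=
        Finset.prod_range_add _ _ _
    _ ≤ K * Real.exp (ε / 2 * r) * Real.exp (ε / 2 * r) :=
        mul_le_mul (hK r hr) htail (Finset.prod_nonneg fun k _ => zero_le_one.trans (hone _))
          (by positivity)
    _ = K * Real.exp (ε * r) := by rw [mul_assoc, ← Real.exp_add, ← add_mul, add_halves]

end ProductGrowth

section TypeOfNevA

theorem isMinimalType_kerQ_zero (h : IsIndeterminate s) : IsMinimalType fun z => kerQ s z 0 := by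
  intro ε hε
  obtain ⟨K, hK⟩ := exists_prod_range_one_add_mul_le_mul_exp
    (fun k => sq_nonneg (pairNorm s (0 : ℂ) k)) (h.summable_pairNorm_sq 0) hε
  refine ⟨(∑' k, pairNorm s (0 : ℂ) k ^ 2) * K, fun z => ?_⟩
  rw [mul_assoc, ← tsum_mul_right]
  refine tsum_of_norm_bounded ((h.summable_pairNorm_sq 0).mul_right _).hasSum fun k => ?_
  have hgrowth : ‖aeval z (Q s k)‖ ≤ pairNorm s (0 : ℂ) k * (K * Real.exp (ε * ‖z‖)) := by
    refine (norm_aeval_Q_le_pairNorm s z k).trans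
      ((pairNorm_le_mul_prod h.isPosDef z 0 k).trans ?_)
    rw [sub_zero]
    exact mul_le_mul_of_nonneg_left (hK _ (norm_nonneg z) k) (pairNorm_nonneg s 0 k)
  calc ‖aeval z (Q s k) * aeval 0 (Q s k)‖
      ≤ pairNorm s (0 : ℂ) k * (K * Real.exp (ε * ‖z‖)) * pairNorm s (0 : ℂ) k := by
        rw [norm_mul]
        exact mul_le_mul hgrowth (norm_aeval_Q_le_pairNorm s 0 k) (norm_nonneg _)
          ((norm_nonneg _).trans hgrowth)
    _ = pairNorm s (0 : ℂ) k ^ 2 * (K * Real.exp (ε * ‖z‖)) := by ring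

theorem isMinimalType_nevA (h : IsIndeterminate s) : IsMinimalType (nevA s) := by
  rw [show (nevA s : ℂ → ℂ) = fun z => z * kerQ s z 0 from _root_.funext (nevA_eq s)]
  exact isMinimalType_id.mul (isMinimalType_kerQ_zero h)

end TypeOfNevA

section Enumeration

theorem exists_strictMono_range_eq {α : Type*} [LinearOrder α] {Z : Set α} (hinf : Z.Infinite)
    (hfin : ∀ b, (Z ∩ Set.Iic b).Finite) : ∃ a : ℕ → α, StrictMono a ∧ Set.range a = Z := by
  have hIic : ∀ b : Z, (Set.Iic b).Finite := fun b =>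
    Set.Finite.of_finite_image ((hfin b).subset (by rintro _ ⟨z, hz, rfl⟩; exact ⟨z.2, hz⟩))
      Subtype.val_injective.injOn
  have := hinf.to_subtype
  let _ := LocallyFiniteOrder.ofFiniteIcc fun _ b => (hIic b).subset Set.Icc_subset_Iic_self
  let _ := LinearLocallyFiniteOrder.succOrder Z
  let _ := LinearLocallyFiniteOrder.predOrder Z
  have : NoMaxOrder Z := ⟨fun b => not_forall_not.1 fun hb =>
    Set.infinite_univ.mono (fun z _ => not_lt.1 (hb z)) (hIic b)⟩
  obtain ⟨m, hm⟩ : ∃ m : Z, ∀ z, m ≤ z := by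
    obtain ⟨z₀⟩ : Nonempty Z := inferInstance
    obtain ⟨m, hmz₀, hm⟩ := (hIic z₀).exists_minimal ⟨z₀, le_rfl⟩
    refine ⟨m, fun z => (le_total z z₀).elim (fun hz => ?_) hmz₀.trans⟩
    exact (le_total m z).elim id (hm hz)
  let _ : OrderBot Z := { bot := m, bot_le := hm }
  let e : ℕ ≃o Z := (orderIsoNatOfLinearSuccPredArch (ι := Z)).symm
  exact ⟨fun n => e n, e.strictMono, by
    rw [Set.range_comp' Subtype.val, e.range_eq, Set.image_univ, Subtype.range_coe]⟩

end Enumeration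

section Zeros

theorem infinite_zeros_nevA (h : IsIndeterminate s) (hS : IsStieltjes s) :
    {x : ℝ | nevA s x = 0}.Infinite := by
  intro hfin
  have hfin' : {z : ℂ | nevA s z = 0}.Finite := (hfin.image ((↑) : ℝ → ℂ)).subset fun z hz => by
    obtain ⟨x, hx, rfl⟩ := (nevA_eq_zero_iff h z).1 hz
    exact ⟨x, hx, rfl⟩
  obtain ⟨p, hp⟩ := (isMinimalType_nevA h).exists_eq_eval (differentiable_nevA h) hfin'
  obtain ⟨q, hq⟩ := exists_norm_eval_le_eval_norm p
  have hratio : ∀ᶠ x in atBot, (q.comp (-X)).eval x / nevA s x ≤ -1 := by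
    filter_upwards [eventually_lt_atBot (0 : ℝ)] with x hx
    have hA := nevA_neg h hS hx
    have hbound := hq (x : ℂ)
    rw [← hp, nevA_ofReal, Complex.norm_real, Complex.norm_real, Real.norm_of_nonpos hA.le,
      Real.norm_of_nonpos hx.le] at hbound
    rw [div_le_iff_of_neg hA, eval_comp, eval_neg, eval_X, neg_one_mul]
    exact hbound
  have := le_of_tendsto (tendsto_eval_div_nevA_atBot h hS (q.comp (-X))) hratio
  linarith

theorem finite_zeros_nevA_inter_Iic (h : IsIndeterminate s) (hS : IsStieltjes s) (M : ℝ) :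
    ({x : ℝ | nevA s x = 0} ∩ Set.Iic M).Finite := by
  by_contra hinf
  have hsub : {x : ℝ | nevA s x = 0} ∩ Set.Iic M ⊆ Set.Icc 0 M := fun x hx =>
    ⟨not_lt.1 fun hneg => (nevA_neg h hS hneg).ne hx.1, hx.2⟩
  obtain ⟨a, -, hacc⟩ := Set.Infinite.exists_accPt_of_subset_isCompact hinf isCompact_Icc hsub
  replace hacc : AccPt a (𝓟 {x : ℝ | nevA s x = 0}) :=
    hacc.mono (principal_mono.2 Set.inter_subset_left)
  have ha : nevA s a = 0 := (isClosed_eq (continuous_nevA h) continuous_const).closure_subset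
    (mem_closure_iff_clusterPt.2 hacc.clusterPt)
  have hderiv : kerQ s a a / nevC s a ≠ 0 :=
    div_ne_zero (kerQ_self_pos h a).ne' (nevC_ne_zero_of_nevA_eq_zero h ha)
  exact accPt_iff_frequently_nhdsNE.1 hacc
    (((hasDerivAt_nevA h ha).eventually_ne hderiv).mono fun x hx h0 => hx h0)

end Zeros

section MainResults

theorem exists_strictMono_nevA_eq_zero_iff (h : IsIndeterminate s) (hS : IsStieltjes s) :
    ∃ a : ℕ → ℝ, StrictMono a ∧ ∀ x : ℝ, nevA s x = 0 ↔ ∃ k, a k = x := by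
  obtain ⟨a, hmono, hrange⟩ :=
    exists_strictMono_range_eq (infinite_zeros_nevA h hS) (finite_zeros_nevA_inter_Iic h hS)
  exact ⟨a, hmono, fun x => (Set.ext_iff.1 hrange x).symm⟩

theorem tendsto_eval_P_div_eval_Q_alpha (h : IsIndeterminate s) (hS : IsStieltjes s) :
    Tendsto (fun n => (P s n).eval 0 / (Q s n).eval 0) atTop (𝓝 (alpha s)) := by
  obtain ⟨a, ha⟩ := exists_tendsto_eval_P_div_eval_Q h.isPosDef hS
  have halpha : alpha s = a := (tendsto_nevD_div_nevB_atBot h hS ha).limUnder_eq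
  rwa [halpha]

end MainResults

end MomentProblem

end

/-- Here `a 0 < a 1 < …` enumerates the zeros `α₁ < α₂ < …` of the entire function `A`. The first
two limits in the last part say that `α(s)` is well defined, by either of its usual formulas. -/
theorem mainTheorem4 (s : ℕ → ℝ) (hindet : MomentProblem.IsIndeterminate s)
    (hstieltjes : MomentProblem.IsStieltjes s) :
    (∃ a : ℕ → ℝ, StrictMono a ∧
      (∀ z : ℂ, MomentProblem.nevA s z = 0 ↔ ∃ k : ℕ, z = (a k : ℂ)) ∧
      StrictAntiOn (fun x : ℝ => MomentProblem.nevC s x / MomentProblem.nevA s x)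
        (Set.Iio (a 0)) ∧
      (∀ k : ℕ, StrictAntiOn (fun x : ℝ => MomentProblem.nevC s x / MomentProblem.nevA s x)
        (Set.Ioo (a k) (a (k + 1)))) ∧
      (∀ k : ℕ, Tendsto (fun x : ℝ => MomentProblem.nevC s x / MomentProblem.nevA s x)
        (𝓝[<] (a k)) atBot) ∧
      (∀ k : ℕ, Tendsto (fun x : ℝ => MomentProblem.nevC s x / MomentProblem.nevA s x)
        (𝓝[>] (a k)) atTop)) ∧
    (Tendsto (fun n : ℕ => (MomentProblem.P s n).eval 0 / (MomentProblem.Q s n).eval 0)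
        atTop (𝓝 (MomentProblem.alpha s)) ∧
      Tendsto (fun x : ℝ => MomentProblem.nevD s x / MomentProblem.nevB s x)
        atBot (𝓝 (MomentProblem.alpha s)) ∧
      Tendsto (fun x : ℝ => MomentProblem.nevC s x / MomentProblem.nevA s x)
        atBot (𝓝 (MomentProblem.alpha s))) := by
  obtain ⟨a, hmono, ha⟩ :=
    MomentProblem.exists_strictMono_nevA_eq_zero_iff hindet hstieltjes
  have hzero : ∀ k, MomentProblem.nevA s (a k) = 0 := fun k => (ha _).2 ⟨k, rfl⟩
  have halpha := MomentProblem.tendsto_eval_P_div_eval_Q_alpha hindet hstieltjes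
  refine ⟨⟨a, hmono, fun z => ?_, ?_, fun k => ?_, fun k => ?_, fun k => ?_⟩, halpha,
    MomentProblem.tendsto_nevD_div_nevB_atBot hindet hstieltjes halpha,
    MomentProblem.tendsto_nevC_div_nevA_atBot hindet hstieltjes halpha⟩
  · simp only [MomentProblem.nevA_eq_zero_iff hindet z, ha, exists_and_right.symm,
      exists_comm (α := ℝ), exists_eq_left']
  · refine MomentProblem.strictAntiOn_nevC_div_nevA hindet (convex_Iio _) fun x hx hx0 => ?_
    obtain ⟨k, rfl⟩ := (ha x).1 hx0
    exact (hmono.monotone k.zero_le).not_gt hx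
  · refine MomentProblem.strictAntiOn_nevC_div_nevA hindet (convex_Ioo _ _) fun x hx hx0 => ?_
    obtain ⟨j, hj⟩ := (ha x).1 hx0
    exact hmono.monotone.ne_of_lt_of_lt_nat k hx.1 hx.2 j hj
  · exact MomentProblem.tendsto_nevC_div_nevA_nhdsLT hindet (hzero k)
  · exact MomentProblem.tendsto_nevC_div_nevA_nhdsGT hindet (hzero k)
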